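/- Let $a_1,a_2$ be linearly independent vectors of $\mathbb R^2$, let $b_1,b_2\in\mathbb R^2$ satisfy $a_i\cdot b_j=2\pi\delta_{ij}$, and put $$\Lambda=\mathbb Z a_1+\mathbb Z a_2,\qquad \Lambda^*=\mathbb Z b_1+\mathbb Z b_2,\qquad k(\kappa_1,\kappa_2)=\kappa_1b_1+\kappa_2b_2,\qquad I=[-\tfrac12,\tfrac12],$$ $D^*=\{k(\kappa_1,\kappa_2):\kappa_1,\kappa_2\in I\}$ and $V=|\{r_1a_1+r_2a_2:r_1,r_2\in I\}|$. Let $H:\mathbb R^2\to\mathbb C^{n\times n}$ be a $\Lambda^*$-periodic family of Hermitian matrices with real-analytic entries, and let $E:\mathbb R^2\to\mathbb R$ be a continuous function such that $E(k)$ is a simple (non-degenerate) eigenvalue of $H(k)$ for every $k$. Let $P(k)$ be the orthogonal projection onto the eigenspace of $H(k)$ for $E(k)$, and let $$\Omega_{xy}=\mathrm i\,\mathrm{Tr}\Big(P\Big[\frac{\partial P}{\partial k_x},\frac{\partial P}{\partial k_y}\Big]\Big),\qquad C_1=\frac1{2\pi}\int_{D^*}\Omega_{xy}(k)\,dk$$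 be the Berry curvature and the first Chern number. Let $v^0$ be a unit eigenvector of $H(k^0)$ for $E(k^0)$, where $k^0=k(-\frac12,-\frac12)$. Consider the following construction. 1. Let $u_0:I\to\mathbb C^n$ solve $u_0'(\kappa_1)=\frac{\partial}{\partial\kappa_1}P(k(\kappa_1,-\frac12))\,u_0(\kappa_1)$ with $u_0(-\frac12)=v^0$; let $\varphi_1\in\mathbb R$ satisfy $u_0(\frac12)=e^{\mathrm i\varphi_1}u_0(-\frac12)$. 2. For each $\kappa_1\in I$ let $u(\kappa_1,\cdot):I\to\mathbb C^n$ solve $\frac{\partial}{\partial\kappa_2}u(\kappa_1,\kappa_2)=\frac{\partial}{\partial\kappa_2}P(k(\kappa_1,\kappa_2))\,u(\kappa_1,\kappa_2)$ with $u(\kappa_1,-\frac12)=e^{-\mathrm i\varphi_1(\kappa_1+\frac12)}u_0(\kappa_1)$. 3. Let $\varphi_2:I\to\mathbb R$ be a continuous function with $u(\kappa_1,\frac12)=e^{\mathrm i\varphi_2(\kappa_1)}u(\kappa_1,-\frac12)$ for all $\kappa_1\in I$, and put $$\tilde u(k(\kappa_1,\kappa_2))=e^{-\mathrm i\varphi_2(\kappa_1)(\kappa_2+\frac12)}u(\kappa_1,\kappa_2),\qquad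 \kappa_1,\kappa_2\in I.$$ **Theorem.** Suppose that $C_1=0$. Then the construction can be carried out, and for every choice of $u_0,\varphi_1,u,\varphi_2$ as above, $\tilde u$ is an analytic and $\Lambda^*$-periodic assignment of eigenvectors on $D^*$: it extends to a real-analytic, $\Lambda^*$-periodic function $\tilde u:\mathbb R^2\to\mathbb C^n$ with $H(k)\tilde u(k)=E(k)\tilde u(k)$ and $\|\tilde u(k)\|=1$ for all $k\in\mathbb R^2$. Consequently the Wannier function of $\tilde u$ is exponentially localized: there are $C,\delta>0$ such that the Fourier coefficients $$\tilde u_{i,R}=\frac{V}{(2\pi)^2}\int_{D^*}e^{-\mathrm iR\cdot k}\,\tilde u_i(k)\,dk$$ satisfy $|\tilde u_{i,R}|\le Ce^{-\delta\|R\|}$ for all $R\in\Lambda$ and $1\le i\le n$; and whenever $\phi_1,\dots,\phi_n:\mathbb R^2\to\mathbb R$ are orbitals with $|\phi_i(r)|\le ce^{-\eta\|r\|}$ on $\mathbb R^2$ for some $c,\eta>0$, the Wannier function $$W_0(r)=\frac{V}{(2\pi)^2}\int_{D^*}\sum_{i=1}^n\tilde u_i(k)\sum_{R\in\Lambda}e^{-\mathrm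 ik\cdot R}\phi_i(r+R)\,dk$$ satisfies $|W_0(r)|\le C'e^{-\delta'\|r\|}$ on $\mathbb R^2$ for some $C',\delta'>0$. -/

import Mathlib

noncomputable section

namespace MatrixModel

open MeasureTheory

/-- The Euclidean plane `ℝ²`. -/
abbrev Plane : Type := EuclideanSpace ℝ (Fin 2)

/-- The space `ℂⁿ` with its standard inner product. -/
abbrev State (n : ℕ) : Type := EuclideanSpace ℂ (Fin n)

/-- The parameter interval `[-1/2, 1/2]`. -/
def paramInterval : Set ℝ := Set.Icc (-(1 / 2)) (1 / 2)

/-- The point `t₁ c₁ + t₂ c₂` of the plane. -/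
def point (c : Fin 2 → Plane) (t₁ t₂ : ℝ) : Plane := t₁ • c 0 + t₂ • c 1

/-- The lattice `{m₁ c₁ + m₂ c₂ : m₁, m₂ ∈ ℤ}`. -/
def lattice (c : Fin 2 → Plane) : Set Plane :=
  {R | ∃ m₁ m₂ : ℤ, R = point c m₁ m₂}

/-- The primitive cell `{t₁ c₁ + t₂ c₂ : t₁, t₂ ∈ [-1/2, 1/2]}`. -/
def cell (c : Fin 2 → Plane) : Set Plane :=
  {r | ∃ t₁ ∈ paramInterval, ∃ t₂ ∈ paramInterval, r = point c t₁ t₂}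

/-- The reciprocity relation `aᵢ · bⱼ = 2π δᵢⱼ`. -/
def IsReciprocal (a b : Fin 2 → Plane) : Prop :=
  ∀ i j, inner ℝ (a i) (b j) = if i = j then 2 * Real.pi else 0

/-- Invariance of a function on the plane under translation by the lattice spanned by `c`. -/
def IsLatticePeriodic {X : Type*} (c : Fin 2 → Plane) (f : Plane → X) : Prop :=
  ∀ k, ∀ G ∈ lattice c, f (k + G) = f k

variable {n : ℕ}

/-- The eigenspace of `H k` for the number `E k`. -/
def bandSpace (H : Plane → Matrix (Fin n) (Fin n) ℂ) (E : Plane → ℝ) (k : Plane) :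
    Submodule ℂ (State n) :=
  Module.End.eigenspace (Matrix.toEuclideanLin (H k)) (E k : ℂ)

/-- The spectral projector `P k` of the band: the orthogonal projection onto the eigenspace. -/
def bandProjector (H : Plane → Matrix (Fin n) (Fin n) ℂ) (E : Plane → ℝ) (k : Plane) :
    State n →L[ℂ] State n :=
  (bandSpace H E k).starProjection

/-- The Berry curvature `Ω_xy = i Tr (P [∂P/∂k_x, ∂P/∂k_y])`. -/
def berryCurvature (P : Plane → State n →L[ℂ] State n) (k : Plane) : ℂ :=
  let Px := fderiv ℝ P k (EuclideanSpace.single 0 1)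
  let Py := fderiv ℝ P k (EuclideanSpace.single 1 1)
  Complex.I * LinearMap.trace ℂ (State n) (P k * (Px * Py - Py * Px) : State n →L[ℂ] State n)

/-- The first Chern number `C₁ = (1 / 2π) ∫_{D*} Ω_xy dk`, with `D*` the cell spanned by `b`. -/
def chernNumber (b : Fin 2 → Plane) (P : Plane → State n →L[ℂ] State n) : ℂ :=
  (1 / (2 * Real.pi) : ℂ) * ∫ k in cell b, berryCurvature P k

/-- The vector function `v` solves the parallel transport equation `dv/ds = (dP(γ(s))/ds) v`
along the curve `γ`, for `s ∈ [-1/2, 1/2]` (one-sided derivatives of `v` at the endpoints). -/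
def IsParallelTransport (P : Plane → State n →L[ℂ] State n) (γ : ℝ → Plane)
    (v : ℝ → State n) : Prop :=
  ∀ s ∈ paramInterval,
    HasDerivWithinAt v (deriv (fun t => P (γ t)) s (v s)) paramInterval s

/-- The data of the two-stage construction started from the eigenvector `v₀` at the corner
`k(-1/2, -1/2)`: parallel transport `u₀` along the line `κ₂ = -1/2`, the phase `φ₁` by which
its end values differ, parallel transport `u κ₁` along the line of constant `κ₁` started from
`exp (-i φ₁ (κ₁ + 1/2)) u₀ κ₁`, and a continuous branch `φ₂` of `-i log z`, where
`z κ₁` is the factor by which the end values of `u κ₁` differ. -/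
structure IsTwoStageConstruction (b : Fin 2 → Plane) (P : Plane → State n →L[ℂ] State n)
    (v₀ : State n) (u₀ : ℝ → State n) (φ₁ : ℝ) (u : ℝ → ℝ → State n) (φ₂ : ℝ → ℝ) : Prop where
  initial : u₀ (-(1 / 2)) = v₀
  transport₁ : IsParallelTransport P (fun κ₁ => point b κ₁ (-(1 / 2))) u₀
  phase₁ : u₀ (1 / 2) = Complex.exp (Complex.I * φ₁) • u₀ (-(1 / 2))
  initial₂ : ∀ κ₁ ∈ paramInterval,
    u κ₁ (-(1 / 2)) = Complex.exp (-Complex.I * φ₁ * (κ₁ + 1 / 2)) • u₀ κ₁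
  transport₂ : ∀ κ₁ ∈ paramInterval, IsParallelTransport P (fun κ₂ => point b κ₁ κ₂) (u κ₁)
  continuous_phase₂ : ContinuousOn φ₂ paramInterval
  phase₂ : ∀ κ₁ ∈ paramInterval,
    u κ₁ (1 / 2) = Complex.exp (Complex.I * φ₂ κ₁) • u κ₁ (-(1 / 2))

/-- The corrected assignment `exp (-i φ₂(κ₁) (κ₂ + 1/2)) u(κ₁, κ₂)`, in the parameters of `D*`. -/
def correctedAssignment (u : ℝ → ℝ → State n) (φ₂ : ℝ → ℝ) (κ₁ κ₂ : ℝ) : State n :=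
  Complex.exp (-Complex.I * φ₂ κ₁ * (κ₂ + 1 / 2)) • u κ₁ κ₂

/-- The Fourier coefficient `u_{i,R} = (V / (2π)²) ∫_{D*} e^{-i R·k} u_i(k) dk`, where `V` is the
area of the cell spanned by `a`. -/
def fourierCoefficient (a b : Fin 2 → Plane) (U : Plane → State n) (i : Fin n) (R : Plane) : ℂ :=
  ((volume.real (cell a) / (2 * Real.pi) ^ 2 : ℝ) : ℂ) *
    ∫ k in cell b, Complex.exp (-Complex.I * (inner ℝ R k : ℝ)) * U k i

/-- The Bloch-like function `χ_{k,i}(r) = ∑_R e^{-i k·R} φ_i(r + R)` of the orbital `φ_i`. -/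
def blochLike (a : Fin 2 → Plane) (orb : Plane → ℝ) (k r : Plane) : ℂ :=
  ∑' R : lattice a, Complex.exp (-Complex.I * (inner ℝ k (R : Plane) : ℝ)) * (orb (r + R) : ℂ)

/-- The Wannier function `W₀(r) = (V / (2π)²) ∫_{D*} ∑ᵢ u_i(k) χ_{k,i}(r) dk` of the assignment
`U` for the orbitals `orb i`. -/
def wannierFunction (a b : Fin 2 → Plane) (orb : Fin n → Plane → ℝ) (U : Plane → State n)
    (r : Plane) : ℂ :=
  ((volume.real (cell a) / (2 * Real.pi) ^ 2 : ℝ) : ℂ) *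
    ∫ k in cell b, ∑ i, U k i * blochLike a (orb i) k r

/-- Exponential decay of a function on a set `S` of points of the plane. -/
def DecaysExponentially {X : Type*} [Norm X] (S : Set Plane) (f : Plane → X) : Prop :=
  ∃ C δ : ℝ, 0 < C ∧ 0 < δ ∧ ∀ r ∈ S, ‖f r‖ ≤ C * Real.exp (-δ * ‖r‖)

end MatrixModel

end

/-! ### Analytic dependence of primitives on parameters -/

section

open MeasureTheory Filter Topology Set
open scoped ENNReal NNReal Nat

/-! In the coordinates `(κ₁, κ₂)` the band projector becomes an analytic family `Q` of rank-one
projections. It is analytic because a simple eigenvalue and its eigenline depend analytically on `k`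
(`analyticOnNhd_bandProjector`). It is 1-periodic in both variables because the band itself is
periodic (`isLatticePeriodic_eigenvalue`): otherwise `E (k + m G)` would be strictly monotone in `m`
and give one matrix infinitely many eigenvalues.

A unit vector of the line `Q` moved by `u' = Q' u` stays in the line, keeps its norm and satisfies
`⟪u, u'⟫ = 0`. The coefficients are periodic, so by uniqueness a translate by one period is a
multiple of the solution, with a factor constant along the transport: `u₀ (κ₁ + 1) = exp (i φ₁) u₀
κ₁` and `u (κ₁, κ₂ + 1) = z κ₁ u (κ₁, κ₂)`. The correction `exp (-i φ₁ (κ₁ + 1/2))` makes the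
initial values of the second stage, hence `u` and `z`, periodic in `κ₁`. It remains to take a
periodic logarithm of `z`.

In the gauge `⟪u, ∂₂u⟫ = 0` the connection coefficient `⟪u, ∂₁u⟫` has `κ₂`-derivative minus the
curvature trace (`hasDerivAt_connection`). Therefore `z' / z` is minus the integral of the curvature
trace over `κ₂`, and the phase of `z` grows over one period by `2π C₁` up to sign. For `C₁ = 0` the
phase is periodic as well as analytic (`exists_periodic_phase`), and `exp (-i φ₂ (κ₂ + 1/2))`
unwinds `u` to a doubly periodic section. Any other data of the construction agree with the global
analytic ones by uniqueness for linear equations and for continuous branches of the logarithm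
(`IsTwoStageConstruction.exists_extension`).

Joint analyticity of the transport (`analyticOnNhd_transport`) rests on a local formula: near a base
point the transported section is `c(κ₁) exp (-G) Q v` with `v` fixed and `G` a primitive in `κ₂` of
an analytic function.

Decay follows by integrating by parts against derivatives of factorial growth
(`norm_fourier_integral_le_of_factorial_growth`); the Wannier function is a lattice convolution of
the orbitals with the Fourier coefficients (`wannierFunction_eq`). -/

/-- Averaging an analytic function along a continuous family of linear contractions. -/
theorem AnalyticAt.intervalIntegral_comp_clm {E F : Type*} [NormedAddCommGroup E] [NormedSpace ℝ E]
    [NormedAddCommGroup F] [NormedSpace ℝ F] [CompleteSpace F] {f : E → F}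
    (hf : AnalyticAt ℝ f 0) {L : ℝ → E →L[ℝ] E} (hL : Continuous L)
    (hL1 : ∀ t ∈ Icc (0 : ℝ) 1, ‖L t‖ ≤ 1) :
    AnalyticAt ℝ (fun y => ∫ t in (0 : ℝ)..1, f (L t y)) 0 := by
  obtain ⟨p, r, hp⟩ := hf
  let Q : ∀ n : ℕ, ℝ → ContinuousMultilinearMap ℝ (fun _ : Fin n => E) F :=
    fun n t => (p n).compContinuousLinearMap (fun _ => L t)
  have hQc : ∀ n, Continuous (Q n) := by
    intro n
    have h := (ContinuousMultilinearMap.compContinuousLinearMapContinuousMultilinear ℝ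
      (fun _ : Fin n => E) (fun _ : Fin n => E) F).cont
    have h2 : Continuous (fun t : ℝ => (fun _ : Fin n => L t)) := continuous_pi fun _ => hL
    exact ((h.comp h2).clm_apply continuous_const : _)
  have hQn : ∀ n, ∀ t ∈ Icc (0 : ℝ) 1, ‖Q n t‖ ≤ ‖p n‖ := by
    intro n t ht
    refine (ContinuousMultilinearMap.norm_compContinuousLinearMap_le _ _).trans ?_
    refine mul_le_of_le_one_right (norm_nonneg _) ?_
    simpa using pow_le_one₀ (norm_nonneg _) (hL1 t ht)
  have h01 : ∀ t, t ∈ uIoc (0 : ℝ) 1 → t ∈ Icc (0 : ℝ) 1 := by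
    intro t ht
    rw [uIoc_of_le zero_le_one] at ht
    exact Ioc_subset_Icc_self ht
  -- The averaged power series. Contractions do not increase the norms of the coefficients, so its
  -- radius is at least that of `p`, and `‖p n‖ * ‖y‖ ^ n` dominates when sum and integral are
  -- exchanged.
  let q : FormalMultilinearSeries ℝ E F := fun n => ∫ t in (0 : ℝ)..1, Q n t
  have hqn : ∀ n, ‖q n‖ ≤ ‖p n‖ := by
    intro n
    have := intervalIntegral.norm_integral_le_of_norm_le_const
      (f := Q n) (C := ‖p n‖) (a := 0) (b := 1) (fun t ht => hQn n t (h01 t ht))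
    simpa using this
  refine ⟨q, r, ?_, hp.r_pos, ?_⟩
  · exact hp.r_le.trans (FormalMultilinearSeries.radius_le_of_le hqn)
  · intro y hy
    have hy' : ∀ t ∈ Icc (0 : ℝ) 1, L t y ∈ Metric.eball (0 : E) r := by
      intro t ht
      rw [mem_eball_zero_iff] at hy ⊢
      refine lt_of_le_of_lt ?_ hy
      rw [enorm_le_iff_norm_le]
      exact ((L t).le_opNorm y).trans (mul_le_of_le_one_left (norm_nonneg _) (hL1 t ht))
    have happ : ∀ n, (q n fun _ => y) = ∫ t in (0 : ℝ)..1, p n (fun _ => L t y) := by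
      intro n
      have hint : IntervalIntegrable (Q n) volume 0 1 := (hQc n).intervalIntegrable 0 1
      exact ((ContinuousMultilinearMap.apply ℝ (fun _ : Fin n => E) F
        (fun _ => y)).intervalIntegral_comp_comm hint).symm
    simp_rw [happ, zero_add]
    refine intervalIntegral.hasSum_integral_of_dominated_convergence
      (fun n _ => ‖p n‖ * ‖y‖ ^ n) ?_ ?_ ?_ ?_ ?_
    · intro n
      have : Continuous fun t => p n (fun _ => L t y) :=
        (p n).cont.comp (continuous_pi fun _ => hL.clm_apply continuous_const)
      exact this.aestronglyMeasurable
    · intro n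
      refine Eventually.of_forall fun t ht => ?_
      refine ((p n).le_opNorm _).trans ?_
      gcongr
      simp only [Finset.prod_const, Finset.card_univ, Fintype.card_fin]
      gcongr
      exact ((L t).le_opNorm y).trans (mul_le_of_le_one_left (norm_nonneg _) (hL1 t (h01 t ht)))
    · refine Eventually.of_forall fun t _ => ?_
      have hyp : (‖y‖₊ : ℝ≥0∞) < p.radius := lt_of_lt_of_le (mem_eball_zero_iff.1 hy) hp.r_le
      have := p.summable_norm_mul_pow hyp
      simpa only [coe_nnnorm] using this
    · exact intervalIntegrable_const
    · refine Eventually.of_forall fun t ht => ?_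
      have := hp.hasSum (hy' t (h01 t ht))
      simpa using this

/-- A primitive of an analytic function in one variable, the others being parameters,
is jointly analytic near the base point. -/
theorem AnalyticAt.intervalIntegral_snd {E F : Type*} [NormedAddCommGroup E] [NormedSpace ℝ E]
    [NormedAddCommGroup F] [NormedSpace ℝ F] [CompleteSpace F] {f : E × ℝ → F} {x₀ : E} {s₀ : ℝ}
    (hf : AnalyticAt ℝ f (x₀, s₀)) :
    AnalyticAt ℝ (fun p : E × ℝ => ∫ t in s₀..p.2, f (p.1, t)) (x₀, s₀) := by
  -- The substitution `t = s₀ + τ (s - s₀)` turns the primitive into `s - s₀` times an average over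
  -- `τ ∈ [0, 1]`, along the maps `(x, s) ↦ (x, τ s)`, which are contractions for the sup norm.
  let L : ℝ → (E × ℝ) →L[ℝ] (E × ℝ) := fun t =>
    (ContinuousLinearMap.inl ℝ E ℝ ∘L ContinuousLinearMap.fst ℝ E ℝ) +
      t • (ContinuousLinearMap.inr ℝ E ℝ ∘L ContinuousLinearMap.snd ℝ E ℝ)
  have hLa : ∀ t (p : E × ℝ), L t p = (p.1, t * p.2) := by
    intro t p
    simp [L]
  have hL : Continuous L := by fun_prop
  have hL1 : ∀ t ∈ Icc (0 : ℝ) 1, ‖L t‖ ≤ 1 := by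
    intro t ht
    refine ContinuousLinearMap.opNorm_le_bound _ zero_le_one fun p => ?_
    rw [hLa, one_mul, Prod.norm_def, Prod.norm_def]
    refine max_le_max le_rfl ?_
    simp only [norm_mul, Real.norm_eq_abs, abs_of_nonneg ht.1]
    exact mul_le_of_le_one_left (abs_nonneg _) ht.2
  have hf0 : AnalyticAt ℝ (fun q : E × ℝ => f ((x₀, s₀) + q)) 0 := by
    have h1 : AnalyticAt ℝ (fun q : E × ℝ => (x₀, s₀) + q) 0 := by fun_prop
    exact AnalyticAt.comp (by simpa using hf) h1
  have hI := hf0.intervalIntegral_comp_clm hL hL1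
  have hs : AnalyticAt ℝ (fun q : E × ℝ => q - (x₀, s₀)) (x₀, s₀) := by fun_prop
  have hI2 : AnalyticAt ℝ (fun q : E × ℝ =>
      ∫ t in (0 : ℝ)..1, f ((x₀, s₀) + L t (q - (x₀, s₀)))) (x₀, s₀) :=
    AnalyticAt.comp (g := fun y => ∫ t in (0 : ℝ)..1, f ((x₀, s₀) + L t y))
      (by simpa using hI) hs
  have h2 : AnalyticAt ℝ (fun q : E × ℝ => q.2 - s₀) (x₀, s₀) :=
    analyticAt_snd.sub analyticAt_const
  refine (h2.smul hI2).congr (Eventually.of_forall fun q => ?_)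
  simp only [hLa]
  have := intervalIntegral.smul_integral_comp_add_mul (fun t => f (q.1, t)) (a := 0) (b := 1)
    (q.2 - s₀) s₀
  simp only [mul_zero, mul_one, add_zero, add_sub_cancel] at this
  rw [← this]
  simp [mul_comm]

/-- A primitive of an analytic function of one variable is analytic. -/
theorem AnalyticOnNhd.intervalIntegral {F : Type*} [NormedAddCommGroup F] [NormedSpace ℝ F]
    [CompleteSpace F] {f : ℝ → F} (hf : AnalyticOnNhd ℝ f univ) (a : ℝ) :
    AnalyticOnNhd ℝ (fun x => ∫ t in a..x, f t) univ := by
  intro s _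
  have hc : Continuous f := continuousOn_univ.mp hf.continuousOn
  have h1 : AnalyticAt ℝ (fun q : ℝ × ℝ => f q.2) ((0 : ℝ), s) :=
    AnalyticAt.comp (g := f) (hf s trivial) analyticAt_snd
  have h2 := h1.intervalIntegral_snd
  have h3 : AnalyticAt ℝ (fun x => ∫ t in s..x, f t) s :=
    AnalyticAt.comp (g := fun p : ℝ × ℝ => ∫ t in s..p.2, f t) (f := fun x : ℝ => ((0 : ℝ), x))
      h2 (analyticAt_const.prod analyticAt_id)
  refine ((analyticAt_const (v := ∫ t in a..s, f t)).add h3).congr (Eventually.of_forall fun x => ?_)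
  exact intervalIntegral.integral_add_adjacent_intervals (hc.intervalIntegrable _ _)
    (hc.intervalIntegrable _ _)

end

/-! ### Factorial growth of derivatives and decay of Fourier coefficients -/

section

open MeasureTheory Filter Topology Set
open scoped ENNReal NNReal Nat

/-- Near a point where it is analytic, the iterated derivatives of a function are of at most
factorial growth, uniformly. -/
theorem AnalyticAt.exists_iteratedFDeriv_apply_le {E F : Type*} [NormedAddCommGroup E]
    [NormedSpace ℝ E] [NormedAddCommGroup F] [NormedSpace ℝ F] [CompleteSpace F] {f : E → F}
    {z₀ : E} (hf : AnalyticAt ℝ f z₀) (e : E) :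
    ∃ C M : ℝ, 0 < C ∧ 0 < M ∧ ∀ᶠ z in 𝓝 z₀, ∀ j : ℕ,
      ‖iteratedFDeriv ℝ j f z (fun _ => e)‖ ≤ C * M ^ j * j ! := by
  obtain ⟨p, r, hp⟩ := hf
  obtain ⟨ρ, hρ0, hρ⟩ : ∃ ρ : ℝ≥0, 0 < ρ ∧ ((ρ : ℝ≥0∞) + ρ) < r := by
    obtain ⟨r', h0, hr'⟩ := ENNReal.lt_iff_exists_nnreal_btwn.1 hp.r_pos
    refine ⟨r' / 2, by simpa using h0, ?_⟩
    rw [← ENNReal.coe_add, add_halves]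
    exact hr'
  have hρp : ((ρ : ℝ≥0∞) + ρ) < p.radius := hρ.trans_le hp.r_le
  -- The room `ρ + ρ < r` makes one triple series converge; its sum `S` bounds all Taylor
  -- coefficients, times `ρ ^ j`, at all centres within `ρ`.
  have hsum := p.changeOriginSeries_summable_aux₁ hρp
  set S : ℝ≥0 := ∑' s : Σ k l : ℕ, { s : Finset (Fin (k + l)) // s.card = l },
    ‖p (s.1 + s.2.1)‖₊ * ρ ^ s.2.1 * ρ ^ s.1 with hS
  have key : ∀ h : E, ‖h‖₊ ≤ ρ → ∀ j, ‖p.changeOrigin h j‖₊ * ρ ^ j ≤ S := by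
    intro h hh j
    have hlt : (‖h‖₊ : ℝ≥0∞) < p.radius :=
      lt_of_le_of_lt (by exact_mod_cast hh) (lt_of_le_of_lt le_self_add hρp)
    have h2 := p.changeOriginSeries_summable_aux₂
      (lt_of_le_of_lt le_self_add hρp : (ρ : ℝ≥0∞) < p.radius) j
    have h3 : ‖p.changeOrigin h j‖₊ ≤
        ∑' s : Σ l : ℕ, { s : Finset (Fin (j + l)) // s.card = l }, ‖p (j + s.1)‖₊ * ρ ^ s.1 := by
      refine (p.nnnorm_changeOrigin_le j hlt).trans ?_
      refine Summable.tsum_le_tsum (fun s => by gcongr)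
        (NNReal.summable_of_le (fun s => by gcongr) h2) h2
    have h4 := NNReal.summable_sigma.1 hsum
    calc ‖p.changeOrigin h j‖₊ * ρ ^ j
        ≤ (∑' s : Σ l : ℕ, { s : Finset (Fin (j + l)) // s.card = l },
            ‖p (j + s.1)‖₊ * ρ ^ s.1) * ρ ^ j := by gcongr
      _ = ∑' s : Σ l : ℕ, { s : Finset (Fin (j + l)) // s.card = l },
            ‖p (j + s.1)‖₊ * ρ ^ s.1 * ρ ^ j := by rw [NNReal.tsum_mul_right]
      _ ≤ ∑' k, ∑' s : Σ l : ℕ, { s : Finset (Fin (k + l)) // s.card = l },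
            ‖p (k + s.1)‖₊ * ρ ^ s.1 * ρ ^ k := h4.2.le_tsum j (fun _ _ => zero_le)
      _ = S := (hsum.tsum_sigma' h4.1).symm
  -- Adding 1 keeps both constants positive when the series or `e` vanishes.
  refine ⟨S + 1, (‖e‖ + 1) / ρ, by positivity, by positivity, ?_⟩
  filter_upwards [Metric.ball_mem_nhds z₀ (NNReal.coe_pos.2 hρ0)] with z hz j
  have hz' : ‖z - z₀‖₊ ≤ ρ := by
    rw [← NNReal.coe_le_coe, coe_nnnorm, ← dist_eq_norm]
    exact (Metric.mem_ball.1 hz).le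
  have hser := hp.changeOrigin (y := z - z₀)
    (lt_of_le_of_lt (by exact_mod_cast hz') (lt_of_le_of_lt le_self_add hρ))
  rw [add_sub_cancel] at hser
  have hk : ‖p.changeOrigin (z - z₀) j‖ * (ρ : ℝ) ^ j ≤ S := by exact_mod_cast key _ hz' j
  have hρ' : (0 : ℝ) < ρ := hρ0
  rw [← hser.factorial_smul, ← Nat.cast_smul_eq_nsmul ℝ, norm_smul, mul_comm, Real.norm_natCast]
  gcongr
  have h5 : ‖p.changeOrigin (z - z₀) j‖ ≤ S / (ρ : ℝ) ^ j := by
    rw [le_div_iff₀ (by positivity)]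
    exact hk
  calc ‖p.changeOrigin (z - z₀) j fun _ => e‖
      ≤ ‖p.changeOrigin (z - z₀) j‖ * ‖e‖ ^ j := by
        simpa using (p.changeOrigin (z - z₀) j).le_opNorm (fun _ => e)
    _ ≤ (S / (ρ : ℝ) ^ j) * (‖e‖ + 1) ^ j := by gcongr; linarith
    _ = S * ((‖e‖ + 1) / ρ) ^ j := by rw [div_pow]; ring
    _ ≤ (S + 1) * ((‖e‖ + 1) / ρ) ^ j := by gcongr; linarith

/-- Uniform factorial growth of the iterated derivatives of an analytic function on a compact
set. -/
theorem IsCompact.exists_iteratedFDeriv_apply_le {E F : Type*} [NormedAddCommGroup E]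
    [NormedSpace ℝ E] [NormedAddCommGroup F] [NormedSpace ℝ F] [CompleteSpace F] {f : E → F}
    {K : Set E} (hK : IsCompact K) (hf : AnalyticOnNhd ℝ f K) (e : E) :
    ∃ C M : ℝ, 0 < C ∧ 0 < M ∧ ∀ z ∈ K, ∀ j : ℕ,
      ‖iteratedFDeriv ℝ j f z (fun _ => e)‖ ≤ C * M ^ j * j ! := by
  refine hK.induction_on (p := fun K => ∃ C M : ℝ, 0 < C ∧ 0 < M ∧ ∀ z ∈ K, ∀ j : ℕ,
      ‖iteratedFDeriv ℝ j f z (fun _ => e)‖ ≤ C * M ^ j * j !) ?_ ?_ ?_ ?_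
  · exact ⟨1, 1, one_pos, one_pos, by simp⟩
  · rintro s t hst ⟨C, M, hC, hM, h⟩
    exact ⟨C, M, hC, hM, fun z hz => h z (hst hz)⟩
  · rintro s t ⟨C, M, hC, hM, h⟩ ⟨C', M', hC', hM', h'⟩
    refine ⟨max C C', max M M', lt_max_of_lt_left hC, lt_max_of_lt_left hM, ?_⟩
    rintro z (hz | hz) j
    · refine (h z hz j).trans ?_
      gcongr <;> exact le_max_left _ _
    · refine (h' z hz j).trans ?_
      gcongr <;> exact le_max_right _ _
  · intro z hz
    obtain ⟨C, M, hC, hM, h⟩ := (hf z hz).exists_iteratedFDeriv_apply_le e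
    exact ⟨_, mem_nhdsWithin_of_mem_nhds h, C, M, hC, hM, fun z hz => hz⟩

/-- Fourier coefficients of a function with derivatives of factorial growth decay exponentially. -/
theorem norm_fourier_integral_le_of_factorial_growth {g : ℕ → ℝ → ℂ} {C M : ℝ} (hM : 0 < M)
    (hg : ∀ j x, HasDerivAt (g j) (g (j + 1) x) x)
    (hper : ∀ j, g j (1 / 2) = g j (-(1 / 2)))
    (hbd : ∀ x ∈ Icc (-(1 / 2) : ℝ) (1 / 2), ∀ j, ‖g j x‖ ≤ C * M ^ j * j !) (m : ℤ) :
    ‖∫ x in (-(1 / 2) : ℝ)..(1 / 2), Complex.exp (-(2 * Real.pi * m * x) * Complex.I) * g 0 x‖ ≤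
      2 * C * Real.exp (-(Real.pi / M) * |(m : ℝ)|) := by
  have hgc : ∀ j, Continuous (g j) := fun j =>
    continuous_iff_continuousAt.2 fun x => (hg j x).continuousAt
  set ω : ℂ := 2 * Real.pi * m * Complex.I with hω
  have hωn : ‖ω‖ = 2 * Real.pi * |(m : ℝ)| := by
    simp [hω, abs_of_pos Real.pi_pos]
  set e : ℝ → ℂ := fun x => Complex.exp (-(2 * Real.pi * m * x) * Complex.I) with he
  have hed : ∀ x, HasDerivAt e (-ω * e x) x := by
    intro x
    have h1 : HasDerivAt (fun x : ℝ => -(2 * Real.pi * m * (x : ℂ)) * Complex.I) (-ω) x := by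
      have := ((Complex.ofRealCLM.hasDerivAt (x := x)).const_mul
        (2 * Real.pi * m : ℂ)).neg.mul_const Complex.I
      simpa [hω] using! this
    have := h1.cexp
    rw [mul_comm]
    exact this
  have hec : Continuous e := continuous_iff_continuousAt.2 fun x => (hed x).continuousAt
  have hen : ∀ x, ‖e x‖ = 1 := by
    intro x
    have := Complex.norm_exp_ofReal_mul_I (-(2 * Real.pi * m * x))
    rw [← this]
    simp [he]
  have hep : e (1 / 2) = e (-(1 / 2)) := by
    simp only [he]
    rw [Complex.exp_eq_exp_iff_exists_int]
    refine ⟨-m, ?_⟩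
    push_cast
    ring
  let A : ℕ → ℂ := fun j => ∫ x in (-(1 / 2) : ℝ)..(1 / 2), e x * g j x
  -- Integration by parts; the boundary terms cancel by periodicity of `e` and of `g j`.
  have hA : ∀ j, A (j + 1) = ω * A j := by
    intro j
    have hd : ∀ x ∈ uIcc (-(1 / 2) : ℝ) (1 / 2), HasDerivAt (fun x => e x * g j x)
        (e x * g (j + 1) x - ω * (e x * g j x)) x := by
      intro x _
      refine ((hed x).mul (hg j x)).congr_deriv ?_
      ring
    have hi : ∀ j, IntervalIntegrable (fun x => e x * g j x) volume (-(1 / 2)) (1 / 2) :=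
      fun j => (hec.mul (hgc j)).intervalIntegrable _ _
    have := intervalIntegral.integral_eq_sub_of_hasDerivAt hd
      ((hi (j + 1)).sub ((hi j).const_mul ω))
    rw [intervalIntegral.integral_sub (hi (j + 1)) ((hi j).const_mul ω),
      intervalIntegral.integral_const_mul, hep, hper, sub_self, sub_eq_zero] at this
    exact this
  have hApow : ∀ j, A j = ω ^ j * A 0 := by
    intro j
    induction j with
    | zero => simp
    | succ j ih => rw [hA, ih, pow_succ]; ring
  have hAbd : ∀ j, ‖A j‖ ≤ C * M ^ j * j ! := by
    intro j
    have := intervalIntegral.norm_integral_le_of_norm_le_const (f := fun x => e x * g j x)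
      (C := C * M ^ j * j !) (a := -(1 / 2)) (b := 1 / 2) (fun x hx => by
        rw [uIoc_of_le (by norm_num)] at hx
        rw [norm_mul, hen, one_mul]
        exact hbd x (Ioc_subset_Icc_self hx) j)
    refine this.trans_eq ?_
    norm_num
  -- Instead of choosing the best `j`, all the bounds `‖ω‖ ^ j * ‖A 0‖ ≤ C * M ^ j * j !` are
  -- divided by `(2 * M) ^ j * j !` and summed. With `y = ‖ω‖ / (2 * M)` the left side sums to `exp
  -- y * ‖A 0‖`, the right side to the geometric series `2 * C`.
  set y : ℝ := Real.pi * |(m : ℝ)| / M with hy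
  have hterm : ∀ j : ℕ, y ^ j / j ! * ‖A 0‖ ≤ C * (1 / 2) ^ j := by
    intro j
    have h1 := hAbd j
    rw [hApow, norm_mul, norm_pow, hωn] at h1
    have hj : (0 : ℝ) < j ! := by exact_mod_cast j.factorial_pos
    have h2 : y ^ j / j ! * ‖A 0‖ =
        ((2 * Real.pi * |(m : ℝ)|) ^ j * ‖A 0‖) / ((2 * M) ^ j * j !) := by
      have : y = (2 * Real.pi * |(m : ℝ)|) / (2 * M) := by rw [hy]; field_simp
      rw [this, div_pow]
      field_simp
    rw [h2, div_le_iff₀ (by positivity)]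
    refine h1.trans_eq ?_
    rw [mul_pow 2 M, one_div, inv_pow]
    field_simp
  have hs1 : HasSum (fun j : ℕ => y ^ j / j ! * ‖A 0‖) (Real.exp y * ‖A 0‖) := by
    refine HasSum.mul_right _ ?_
    rw [Real.exp_eq_exp_ℝ]
    exact NormedSpace.expSeries_div_hasSum_exp y
  have hs2 : HasSum (fun j : ℕ => C * (1 / 2 : ℝ) ^ j) (C * 2) := hasSum_geometric_two.mul_left C
  have hfin := hasSum_le hterm hs1 hs2
  have hexp : Real.exp (-(Real.pi / M) * |(m : ℝ)|) = (Real.exp y)⁻¹ := by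
    rw [← Real.exp_neg, hy]
    congr 1
    ring
  rw [hexp, ← div_eq_mul_inv, le_div_iff₀ (Real.exp_pos _)]
  change ‖A 0‖ * _ ≤ _
  linarith

/-- The partial Fourier coefficients of a real-analytic function on the plane that is periodic in
the first variable decay exponentially, uniformly in the second variable. -/
theorem AnalyticOnNhd.exists_norm_fourier_integral_fst_le {f : ℝ × ℝ → ℂ}
    (hf : AnalyticOnNhd ℝ f univ) (hper : ∀ z, f (z + (1, 0)) = f z) :
    ∃ C δ : ℝ, 0 < C ∧ 0 < δ ∧ ∀ m : ℤ, ∀ y ∈ Icc (-(1 / 2) : ℝ) (1 / 2),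
      ‖∫ x in (-(1 / 2) : ℝ)..(1 / 2),
        Complex.exp (-(2 * Real.pi * m * x) * Complex.I) * f (x, y)‖ ≤
      C * Real.exp (-δ * |(m : ℝ)|) := by
  obtain ⟨C, M, hC, hM, h⟩ := ((isCompact_Icc (a := (-(1 / 2) : ℝ)) (b := 1 / 2)).prod
    (isCompact_Icc (a := (-(1 / 2) : ℝ)) (b := 1 / 2))).exists_iteratedFDeriv_apply_le
    (hf.mono (subset_univ _)) (1, 0)
  refine ⟨2 * C, Real.pi / M, by positivity, by positivity, fun m y hy => ?_⟩
  have hcd : ContDiff ℝ ⊤ f := hf.contDiff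
  let g : ℕ → ℝ → ℂ := fun j x => iteratedFDeriv ℝ j f (x, y) (fun _ => (1, 0))
  have hg : ∀ j x, HasDerivAt (g j) (g (j + 1) x) x := by
    intro j x
    have h1 : HasFDerivAt (iteratedFDeriv ℝ j f) (fderiv ℝ (iteratedFDeriv ℝ j f) (x, y)) (x, y) :=
      ((hcd.differentiable_iteratedFDeriv (m := j) (WithTop.coe_lt_top _)) (x, y)).hasFDerivAt
    have h2 : HasDerivAt (fun x : ℝ => (x, y)) ((1 : ℝ), (0 : ℝ)) x :=
      (hasDerivAt_id x).prodMk (hasDerivAt_const x y)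
    have h3 := h1.comp_hasDerivAt x h2
    have h4 := (ContinuousMultilinearMap.apply ℝ (fun _ : Fin j => ℝ × ℝ) ℂ
      (fun _ => (1, 0))).hasFDerivAt.comp_hasDerivAt x h3
    exact h4
  have hshift : (fun z => f (z + (1, 0))) = f := funext hper
  refine norm_fourier_integral_le_of_factorial_growth hM hg ?_ ?_ m
  · intro j
    simp only [g]
    have h5 := iteratedFDeriv_comp_add_right (𝕜 := ℝ) (f := f) j ((1 : ℝ), (0 : ℝ))
      ((-(1 / 2) : ℝ), y)
    rw [hshift] at h5
    rw [h5]
    norm_num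
  · intro x hx j
    exact h (x, y) ⟨hx, hy⟩ j

/-- The Fourier coefficients of a doubly periodic real-analytic function decay exponentially. -/
theorem AnalyticOnNhd.exists_norm_fourier_integral_le {f : ℝ × ℝ → ℂ}
    (hf : AnalyticOnNhd ℝ f univ) (hper₁ : ∀ z, f (z + (1, 0)) = f z)
    (hper₂ : ∀ z, f (z + (0, 1)) = f z) :
    ∃ C δ : ℝ, 0 < C ∧ 0 < δ ∧ ∀ m₁ m₂ : ℤ,
      ‖∫ x in (-(1 / 2) : ℝ)..(1 / 2), ∫ y in (-(1 / 2) : ℝ)..(1 / 2),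
        Complex.exp (-(2 * Real.pi * (m₁ * x + m₂ * y)) * Complex.I) * f (x, y)‖ ≤
      C * Real.exp (-δ * (|(m₁ : ℝ)| + |(m₂ : ℝ)|)) := by
  have hfc : Continuous f := continuousOn_univ.mp hf.continuousOn
  have hswap : AnalyticOnNhd ℝ (fun z : ℝ × ℝ => f (z.2, z.1)) univ := fun z _ =>
    AnalyticAt.comp (g := f) (f := fun z : ℝ × ℝ => (z.2, z.1)) (hf _ trivial)
      (analyticAt_snd.prod analyticAt_fst)
  obtain ⟨C₁, δ₁, hC₁, hδ₁, h₁⟩ := hf.exists_norm_fourier_integral_fst_le hper₁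
  obtain ⟨C₂, δ₂, hC₂, hδ₂, h₂⟩ := hswap.exists_norm_fourier_integral_fst_le
    (fun z => by simpa using hper₂ (z.2, z.1))
  refine ⟨max C₁ C₂, min δ₁ δ₂ / 2, lt_max_of_lt_left hC₁, half_pos (lt_min hδ₁ hδ₂),
    fun m₁ m₂ => ?_⟩
  have hexp : ∀ x y : ℝ, Complex.exp (-(2 * Real.pi * (m₁ * x + m₂ * y)) * Complex.I) =
      Complex.exp (-(2 * Real.pi * m₁ * x) * Complex.I) *
        Complex.exp (-(2 * Real.pi * m₂ * y) * Complex.I) := by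
    intro x y
    rw [← Complex.exp_add]
    congr 1
    ring
  have hen : ∀ (m : ℤ) (x : ℝ), ‖Complex.exp (-(2 * Real.pi * m * x) * Complex.I)‖ = 1 := by
    intro m x
    rw [← Complex.norm_exp_ofReal_mul_I (-(2 * Real.pi * m * x))]
    simp
  have hbound₂ : ‖∫ x in (-(1 / 2) : ℝ)..(1 / 2), ∫ y in (-(1 / 2) : ℝ)..(1 / 2),
        Complex.exp (-(2 * Real.pi * (m₁ * x + m₂ * y)) * Complex.I) * f (x, y)‖ ≤
      C₂ * Real.exp (-δ₂ * |(m₂ : ℝ)|) := by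
    refine (intervalIntegral.norm_integral_le_of_norm_le_const
      (C := C₂ * Real.exp (-δ₂ * |(m₂ : ℝ)|)) fun x hx => ?_).trans_eq (by norm_num)
    rw [uIoc_of_le (by norm_num)] at hx
    simp only [hexp, mul_assoc (Complex.exp (-(2 * Real.pi * m₁ * _) * Complex.I))]
    rw [intervalIntegral.integral_const_mul, norm_mul, hen, one_mul]
    exact h₂ m₂ x (Ioc_subset_Icc_self hx)
  have hbound₁ : ‖∫ x in (-(1 / 2) : ℝ)..(1 / 2), ∫ y in (-(1 / 2) : ℝ)..(1 / 2),
        Complex.exp (-(2 * Real.pi * (m₁ * x + m₂ * y)) * Complex.I) * f (x, y)‖ ≤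
      C₁ * Real.exp (-δ₁ * |(m₁ : ℝ)|) := by
    rw [intervalIntegral_intervalIntegral_swap]
    · refine (intervalIntegral.norm_integral_le_of_norm_le_const
        (C := C₁ * Real.exp (-δ₁ * |(m₁ : ℝ)|)) fun y hy => ?_).trans_eq (by norm_num)
      rw [uIoc_of_le (by norm_num)] at hy
      simp only [hexp, mul_comm (Complex.exp (-(2 * Real.pi * m₁ * _) * Complex.I)),
        mul_assoc (Complex.exp (-(2 * Real.pi * m₂ * _) * Complex.I))]
      rw [intervalIntegral.integral_const_mul, norm_mul, hen, one_mul]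
      simp only [mul_comm (f _)]
      exact h₁ m₁ y (Ioc_subset_Icc_self hy)
    · refine (ContinuousOn.integrableOn_compact (isCompact_uIcc.prod isCompact_uIcc)
        (Continuous.continuousOn ?_)).mono_set (prod_mono uIoc_subset_uIcc uIoc_subset_uIcc)
      simp only [Function.uncurry_def]
      fun_prop
  -- The bound in the larger index is used; that index is at least half of `|m₁| + |m₂|`, whence the
  -- halved rate.
  rcases le_total |(m₁ : ℝ)| |(m₂ : ℝ)| with hm | hm
  · refine hbound₂.trans ?_
    refine mul_le_mul (le_max_right _ _) (Real.exp_le_exp.2 ?_) (by positivity) (by positivity)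
    · have := min_le_right δ₁ δ₂
      have h0 := abs_nonneg (m₁ : ℝ)
      have h3 : 0 < min δ₁ δ₂ := lt_min hδ₁ hδ₂
      nlinarith
  · refine hbound₁.trans ?_
    refine mul_le_mul (le_max_left _ _) (Real.exp_le_exp.2 ?_) (by positivity) (by positivity)
    · have := min_le_left δ₁ δ₂
      have h0 := abs_nonneg (m₂ : ℝ)
      have h3 : 0 < min δ₁ δ₂ := lt_min hδ₁ hδ₂
      nlinarith

end

/-! ### Linear differential equations with skew-adjoint coefficients -/

section

open MeasureTheory Filter Topology Set
open scoped ENNReal NNReal Nat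

namespace MatrixModel
variable {n : ℕ}

/-- Uniqueness for linear differential equations on an open interval. -/
theorem eqOn_Ioo_of_hasDerivAt_clm {A : ℝ → State n →L[ℂ] State n} (hA : Continuous A)
    {a b t₀ : ℝ} (ht₀ : t₀ ∈ Ioo a b) {f g : ℝ → State n}
    (hf : ∀ t ∈ Ioo a b, HasDerivAt f (A t (f t)) t)
    (hg : ∀ t ∈ Ioo a b, HasDerivAt g (A t (g t)) t) (h : f t₀ = g t₀) : EqOn f g (Ioo a b) := by
  obtain ⟨K, hK⟩ := (isCompact_Icc (a := a) (b := b)).exists_bound_of_continuousOn hA.continuousOn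
  refine ODE_solution_unique_of_mem_Ioo (v := fun t x => A t x) (s := fun _ => univ)
    (K := K.toNNReal) (fun t ht => ?_) ht₀ (fun t ht => ⟨hf t ht, trivial⟩)
    (fun t ht => ⟨hg t ht, trivial⟩) h
  refine LipschitzWith.lipschitzOnWith ?_
  refine (A t).lipschitz.weaken ?_
  rw [← NNReal.coe_le_coe]
  exact (hK t (Ioo_subset_Icc_self ht)).trans (Real.le_coe_toNNReal K)

/-- Uniqueness for linear differential equations on a closed interval, with one-sided
derivatives at the end points. -/
theorem eqOn_Icc_of_hasDerivWithinAt_clm {A : ℝ → State n →L[ℂ] State n} (hA : Continuous A)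
    {a b : ℝ} {f g : ℝ → State n}
    (hf : ∀ t ∈ Icc a b, HasDerivWithinAt f (A t (f t)) (Icc a b) t)
    (hg : ∀ t ∈ Icc a b, HasDerivWithinAt g (A t (g t)) (Icc a b) t) (h : f a = g a) :
    EqOn f g (Icc a b) := by
  obtain ⟨K, hK⟩ := (isCompact_Icc (a := a) (b := b)).exists_bound_of_continuousOn hA.continuousOn
  refine ODE_solution_unique_of_mem_Icc_right (v := fun t x => A t x) (s := fun _ => univ)
    (K := K.toNNReal) (fun t ht => ?_) (fun t ht => (hf t ht).continuousWithinAt)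
    (fun t ht => ?_) (fun _ _ => trivial) (fun t ht => (hg t ht).continuousWithinAt)
    (fun t ht => ?_) (fun _ _ => trivial) h
  · refine LipschitzWith.lipschitzOnWith ((A t).lipschitz.weaken ?_)
    rw [← NNReal.coe_le_coe]
    exact (hK t (Ico_subset_Icc_self ht)).trans (Real.le_coe_toNNReal K)
  · exact (hf t (Ico_subset_Icc_self ht)).mono_of_mem_nhdsWithin
      (Icc_mem_nhdsGE_of_mem ht)
  · exact (hg t (Ico_subset_Icc_self ht)).mono_of_mem_nhdsWithin
      (Icc_mem_nhdsGE_of_mem ht)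

/-- Global solutions of linear equations with skew-adjoint coefficients, on a bounded interval. -/
theorem exists_forall_Icc_hasDerivWithinAt_of_skew {A : ℝ → State n →L[ℂ] State n}
    (hA : Continuous A) (hskew : ∀ t x, (inner ℂ x (A t x)).re = 0) (t₀ T : ℝ) (hT : 0 < T)
    {v : State n} (hv : ‖v‖ = 1) :
    ∃ u : ℝ → State n, u t₀ = v ∧ ∀ t ∈ Icc (t₀ - T) (t₀ + T),
      HasDerivWithinAt u (A t (u t)) (Icc (t₀ - T) (t₀ + T)) t ∧ ‖u t‖ = 1 := by
  obtain ⟨K, hK⟩ := (isCompact_Icc (a := t₀ - T) (b := t₀ + T)).exists_bound_of_continuousOn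
    hA.continuousOn
  have hK0 : 0 ≤ K := (norm_nonneg _).trans (hK t₀ ⟨by linarith, by linarith⟩)
  -- A truncation that makes the vector field bounded, so that Picard–Lindelöf reaches the whole
  -- interval in one step. As `χ u` is a real multiple of `u`, the truncated field is still
  -- orthogonal to `u` in real part and the norm stays 1; on the unit sphere `χ` is the identity, so
  -- the truncation is never felt.
  let χ : State n → State n := fun u => (2 / (1 + ‖u‖ ^ 2) : ℝ) • u
  have hχd : ContDiff ℝ 1 χ := by
    refine ContDiff.smul (ContDiff.div contDiff_const (contDiff_const.add (contDiff_norm_sq ℝ)) ?_)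
      contDiff_id
    intro x; positivity
  have hχn : ∀ u, ‖χ u‖ ≤ 1 := by
    intro u
    simp only [χ, norm_smul, Real.norm_eq_abs]
    rw [abs_of_pos (by positivity), div_mul_eq_mul_div, div_le_one (by positivity)]
    nlinarith [sq_nonneg (‖u‖ - 1)]
  obtain ⟨Lχ, hLχ⟩ : ∃ L, LipschitzOnWith L χ (Metric.closedBall v (K * T)) :=
    hχd.contDiffOn.exists_lipschitzOnWith one_ne_zero (convex_closedBall v (K * T))
      (isCompact_closedBall v (K * T))
  have hPL : IsPicardLindelof (fun t u => A t (χ u))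
      (⟨t₀, by constructor <;> linarith⟩ : Icc (t₀ - T) (t₀ + T)) v
      ⟨K * T, by positivity⟩ 0 ⟨K, hK0⟩ (⟨K, hK0⟩ * Lχ) := by
    refine ⟨fun t ht => ?_, fun u _ => ?_, fun t ht u _ => ?_, ?_⟩
    · refine LipschitzWith.comp_lipschitzOnWith ((A t).lipschitz.weaken ?_) hLχ
      exact NNReal.coe_le_coe.1 (hK t ht)
    · exact (hA.clm_apply continuous_const).continuousOn
    · refine ((A t).le_opNorm _).trans ?_
      exact (mul_le_mul (hK t ht) (hχn u) (norm_nonneg _) hK0).trans_eq (mul_one K)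
    · simp only [add_sub_cancel_left, sub_sub_cancel, max_self, NNReal.coe_zero, sub_zero]
      exact le_rfl
  obtain ⟨u, hu0, hu⟩ := hPL.exists_eq_forall_mem_Icc_hasDerivWithinAt₀
  have hnorm : ∀ t ∈ Icc (t₀ - T) (t₀ + T), ‖u t‖ = 1 := by
    have hd : ∀ t ∈ Icc (t₀ - T) (t₀ + T),
        HasDerivWithinAt (fun t => ‖u t‖ ^ 2) 0 (Icc (t₀ - T) (t₀ + T)) t := by
      intro t ht
      have h1 := ((hu t ht).inner ℂ (hu t ht))
      have h2 := Complex.reCLM.hasFDerivAt.comp_hasDerivWithinAt t h1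
      have h3 : HasDerivWithinAt (fun t => ‖u t‖ ^ 2) _ (Icc (t₀ - T) (t₀ + T)) t :=
        h2.congr_of_mem (fun s _ => by simp [← inner_self_eq_norm_sq (𝕜 := ℂ)]) ht
      refine h3.congr_deriv ?_
      have h4 : (inner ℂ (u t) (A t (χ (u t)))).re = 0 := by
        simp only [χ]
        rw [← Complex.coe_smul, map_smul, inner_smul_right, Complex.re_ofReal_mul, hskew, mul_zero]
      have h5 : (inner ℂ (A t (χ (u t))) (u t)).re = 0 := by
        rw [← inner_conj_symm, Complex.conj_re, h4]
      simp [h4, h5]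
    have hc : ∀ t ∈ Icc (t₀ - T) (t₀ + T), ‖u t‖ ^ 2 = ‖u t₀‖ ^ 2 := by
      intro t ht
      refine (convex_Icc _ _).is_const_of_fderivWithin_eq_zero (𝕜 := ℝ)
        (f := fun t => ‖u t‖ ^ 2) (fun t ht => (hd t ht).differentiableWithinAt) ?_ ht
        ⟨by linarith, by linarith⟩
      intro t ht
      have := (hd t ht).hasFDerivWithinAt.fderivWithin
        (uniqueDiffOn_Icc (by linarith) t ht)
      rw [this]
      ext
      simp
    intro t ht
    have := hc t ht
    rw [hu0, hv] at this
    nlinarith [norm_nonneg (u t)]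
  refine ⟨u, hu0, fun t ht => ⟨(hu t ht).congr_deriv ?_, hnorm t ht⟩⟩
  simp [χ, hnorm t ht]
  norm_num

/-- Global solutions of linear equations with skew-adjoint coefficients. -/
theorem exists_forall_hasDerivAt_of_skew {A : ℝ → State n →L[ℂ] State n}
    (hA : Continuous A) (hskew : ∀ t x, (inner ℂ x (A t x)).re = 0) (t₀ : ℝ)
    {v : State n} (hv : ‖v‖ = 1) :
    ∃ u : ℝ → State n, u t₀ = v ∧ ∀ t, HasDerivAt u (A t (u t)) t ∧ ‖u t‖ = 1 := by
  choose u hu0 hu using fun T : {T : ℝ // 0 < T} =>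
    exists_forall_Icc_hasDerivWithinAt_of_skew hA hskew t₀ T T.2 hv
  have hd : ∀ (T : {T : ℝ // 0 < T}), ∀ t ∈ Ioo (t₀ - T) (t₀ + T),
      HasDerivAt (u T) (A t (u T t)) t := fun T t ht =>
    ((hu T t (Ioo_subset_Icc_self ht)).1).hasDerivAt (Icc_mem_nhds ht.1 ht.2)
  have hagree : ∀ (S T : {T : ℝ // 0 < T}), S ≤ T →
      EqOn (u S) (u T) (Ioo (t₀ - S) (t₀ + S)) := by
    intro S T hST
    have hST' : (S : ℝ) ≤ T := hST
    have hS := S.2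
    refine eqOn_Ioo_of_hasDerivAt_clm hA (t₀ := t₀) ⟨by linarith, by linarith⟩ (hd S)
      (fun t ht => hd T t ⟨by linarith [ht.1], by linarith [ht.2]⟩) ?_
    rw [hu0, hu0]
  let R : ℝ → {T : ℝ // 0 < T} := fun t => ⟨|t - t₀| + 1, by positivity⟩
  have hmem : ∀ t, t ∈ Ioo (t₀ - R t) (t₀ + R t) := by
    intro t
    have h1 := le_abs_self (t - t₀)
    have h2 := neg_abs_le (t - t₀)
    exact ⟨by simp only [R]; linarith, by simp only [R]; linarith⟩
  refine ⟨fun t => u (R t) t, hu0 _, fun t => ⟨?_, (hu _ t (Ioo_subset_Icc_self (hmem t))).2⟩⟩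
  -- A window large enough to contain the windows `R s` of all `s` within distance 1 of `t`, so that
  -- near `t` the glued function is the single solution `u S`.
  let S : {T : ℝ // 0 < T} := ⟨|t - t₀| + 2, by positivity⟩
  have hev : (fun s => u (R s) s) =ᶠ[𝓝 t] u S := by
    filter_upwards [Metric.ball_mem_nhds t one_pos] with s hs
    have h1 : |s - t| < 1 := by simpa [Real.dist_eq] using hs
    have h2 : |s - t₀| ≤ |t - t₀| + 1 := by
      have := abs_add_le (s - t) (t - t₀)
      rw [sub_add_sub_cancel] at this
      linarith
    refine hagree _ _ ?_ (hmem s)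
    change |s - t₀| + 1 ≤ |t - t₀| + 2
    linarith
  have hS : t ∈ Ioo (t₀ - S) (t₀ + S) := by
    have h1 := le_abs_self (t - t₀)
    have h2 := neg_abs_le (t - t₀)
    exact ⟨by simp only [S]; linarith, by simp only [S]; linarith⟩
  have := (hd S t hS).congr_of_eventuallyEq hev
  rwa [← hev.eq_of_nhds] at this

end MatrixModel

end

/-! ### Rank-one projections and parallel transport -/

section

open MeasureTheory Filter Topology Set
open scoped ENNReal NNReal Nat

namespace MatrixModel
variable {n : ℕ}

/-- The orthogonal projections of rank one, in the form `v ↦ ⟪w, v⟫ w` with a unit vector `w`. -/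
def IsRankOneProjection (A : State n →L[ℂ] State n) : Prop :=
  ∃ w : State n, ‖w‖ = 1 ∧ ∀ v, A v = inner ℂ w v • w

namespace IsRankOneProjection

variable {A : State n →L[ℂ] State n}

theorem apply_apply (hA : IsRankOneProjection A) (v : State n) : A (A v) = A v := by
  obtain ⟨w, hw, h⟩ := hA
  simp [h, inner_self_eq_norm_sq_to_K, hw]

theorem inner_left (hA : IsRankOneProjection A) (x y : State n) :
    inner ℂ (A x) y = inner ℂ x (A y) := by
  obtain ⟨w, hw, h⟩ := hA
  simp [h, mul_comm]

theorem apply_eq (hA : IsRankOneProjection A) {v : State n} (hv : ‖v‖ = 1) (hAv : A v = v)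
    (x : State n) : A x = inner ℂ v x • v := by
  obtain ⟨w, hw, h⟩ := hA
  have h1 : v = inner ℂ w v • w := by rw [← h, hAv]
  have h2 : ‖(inner ℂ w v : ℂ)‖ = 1 := by
    have := congrArg norm h1
    rw [norm_smul, hw, hv, mul_one] at this
    exact this.symm
  have h3 : (starRingEnd ℂ) (inner ℂ w v) * inner ℂ w v = 1 := by
    rw [← Complex.normSq_eq_conj_mul_self, Complex.normSq_eq_norm_sq, h2]
    norm_num
  set c : ℂ := inner ℂ w v
  rw [h x, h1, inner_smul_left, smul_smul, mul_right_comm, h3, one_mul]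

/-- Two vectors in the range of a projection of rank one are proportional. -/
theorem apply_eq_smul (hA : IsRankOneProjection A) {v : State n} (hv : inner ℂ v (A v) ≠ 0)
    (x : State n) : A x = (inner ℂ v (A x) / inner ℂ v (A v)) • A v := by
  obtain ⟨w, hw, h⟩ := hA
  simp only [h, inner_smul_right] at hv ⊢
  rw [smul_smul]
  congr 1
  have h1 := left_ne_zero_of_mul hv
  have h2 := right_ne_zero_of_mul hv
  field_simp

/-- Unit vectors in the range of a projection of rank one differ by a phase. -/
theorem exists_phase (hA : IsRankOneProjection A) {v x : State n} (hv : ‖v‖ = 1) (hAv : A v = v)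
    (hx : ‖x‖ = 1) (hAx : A x = x) : ∃ θ : ℝ, x = Complex.exp (Complex.I * θ) • v := by
  have h1 : x = inner ℂ v x • v := by rw [← hA.apply_eq hv hAv, hAx]
  have h2 : ‖(inner ℂ v x : ℂ)‖ = 1 := by
    have := congrArg norm h1
    rw [norm_smul, hx, hv, mul_one] at this
    exact this.symm
  refine ⟨(inner ℂ v x : ℂ).arg, ?_⟩
  have := Complex.norm_mul_exp_arg_mul_I (inner ℂ v x : ℂ)
  rw [h2, Complex.ofReal_one, one_mul, mul_comm] at this
  rw [this]
  exact h1

end IsRankOneProjection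

section Family

variable {Q Q' : ℝ → State n →L[ℂ] State n}

/-- The derivative of `Q * Q = Q`. Together with `projection_deriv_projection` it says that `Q'` is
off-diagonal with respect to the range of `Q` and its complement. -/
theorem deriv_projection_apply (hQ : ∀ s, IsRankOneProjection (Q s))
    (hd : ∀ s, HasDerivAt Q (Q' s) s) (s : ℝ) (v : State n) :
    Q' s (Q s v) + Q s (Q' s v) = Q' s v := by
  have h1 : (fun s => Q s * Q s) = Q := by
    funext s
    ext1 v
    exact (hQ s).apply_apply v
  have h2 : HasDerivAt (fun s => Q s * Q s) (Q' s * Q s + Q s * Q' s) s := (hd s).mul (hd s)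
  rw [h1] at h2
  exact DFunLike.congr_fun (h2.unique (hd s)) v

theorem projection_deriv_projection (hQ : ∀ s, IsRankOneProjection (Q s))
    (hd : ∀ s, HasDerivAt Q (Q' s) s) (s : ℝ) (v : State n) :
    Q s (Q' s (Q s v)) = 0 := by
  have h := congrArg (Q s) (deriv_projection_apply hQ hd s v)
  rw [map_add, (hQ s).apply_apply] at h
  simpa using h

theorem inner_deriv_projection_left (hQ : ∀ s, IsRankOneProjection (Q s))
    (hd : ∀ s, HasDerivAt Q (Q' s) s) (s : ℝ) (x y : State n) :
    inner ℂ (Q' s x) y = inner ℂ x (Q' s y) := by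
  have hx : ∀ x, HasDerivAt (fun s => Q s x) (Q' s x) s := fun x =>
    ((ContinuousLinearMap.apply ℂ (State n) x).restrictScalars ℝ).hasFDerivAt.comp_hasDerivAt s (hd s)
  have h1 := (hx x).inner ℂ (hasDerivAt_const s y)
  have h2 := (hasDerivAt_const s x).inner ℂ (hx y)
  have h3 : (fun s => inner ℂ (Q s x) y) = fun s => inner ℂ x (Q s y) :=
    funext fun s => (hQ s).inner_left x y
  rw [h3] at h1
  simpa using h1.unique h2

/-- Parallel transport exists for all times; it preserves the range of the projection and the
norm. -/
theorem exists_parallel_transport (hQ : ∀ s, IsRankOneProjection (Q s))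
    (hd : ∀ s, HasDerivAt Q (Q' s) s) (hc : Continuous Q') (s₀ : ℝ) {v : State n}
    (hv : ‖v‖ = 1) (hQv : Q s₀ v = v) :
    ∃ u : ℝ → State n, u s₀ = v ∧
      ∀ s, HasDerivAt u (Q' s (u s)) s ∧ Q s (u s) = u s ∧ ‖u s‖ = 1 := by
  have hQc : Continuous Q := continuous_iff_continuousAt.2 fun s => (hd s).continuousAt
  -- The generator `Q'` is self-adjoint, so the norm is not visibly conserved. Kato's generator `Q'
  -- Q - Q Q'` is skew-adjoint, and it agrees with `Q'` on the range of `Q` because `Q Q' Q = 0`.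
  obtain ⟨u, hu0, hu⟩ := exists_forall_hasDerivAt_of_skew
    (A := fun s => Q' s * Q s - Q s * Q' s) ((hc.mul hQc).sub (hQc.mul hc)) (fun s x => by
      have h1 : inner ℂ x (Q' s (Q s x)) = inner ℂ (Q s (Q' s x)) x := by
        rw [(hQ s).inner_left, inner_deriv_projection_left hQ hd]
      change (inner ℂ x (Q' s (Q s x) - Q s (Q' s x))).re = 0
      rw [inner_sub_right, h1, ← inner_conj_symm (Q s (Q' s x)) x, Complex.sub_re,
        Complex.conj_re, sub_self]) s₀ hv
  -- The component outside the range of `Q` solves a linear homogeneous equation with zero initial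
  -- value, hence vanishes.
  have hw : ∀ s, HasDerivAt (fun s => u s - Q s (u s)) ((-Q' s) (u s - Q s (u s))) s := by
    intro s
    have h1 : HasDerivAt (fun s => Q s (u s)) (Q' s (u s) +
        Q s ((Q' s * Q s - Q s * Q' s : State n →L[ℂ] State n) (u s))) s := by
      have h2 : HasDerivAt (fun s => (Q s).restrictScalars ℝ) ((Q' s).restrictScalars ℝ) s :=
        (ContinuousLinearMap.restrictScalarsL ℂ (State n) (State n) ℝ ℝ).hasFDerivAt.comp_hasDerivAt
          s (hd s)
      exact h2.clm_apply (hu s).1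
    refine ((hu s).1.sub h1).congr_deriv ?_
    have e1 := deriv_projection_apply hQ hd s (u s)
    have e2 := projection_deriv_projection hQ hd s (u s)
    have e3 := (hQ s).apply_apply (Q' s (u s))
    change Q' s (Q s (u s)) - Q s (Q' s (u s)) - (Q' s (u s) + Q s (Q' s (Q s (u s)) -
      Q s (Q' s (u s)))) = -(Q' s (u s - Q s (u s)))
    rw [map_sub, map_sub, e2, e3]
    abel
  have hz : ∀ s, u s - Q s (u s) = 0 := by
    intro s
    have := eqOn_Ioo_of_hasDerivAt_clm (A := fun s => -Q' s) hc.neg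
      (a := min s s₀ - 1) (b := max s s₀ + 1) (t₀ := s₀)
      ⟨by linarith [min_le_right s s₀], by linarith [le_max_right s s₀]⟩
      (f := fun s => u s - Q s (u s)) (g := fun _ => 0) (fun t _ => hw t)
      (fun t _ => by simpa using hasDerivAt_const t (0 : State n)) (by simp [hu0, hQv])
    exact this ⟨by linarith [min_le_left s s₀], by linarith [le_max_left s s₀]⟩
  have hQu : ∀ s, Q s (u s) = u s := fun s => (sub_eq_zero.1 (hz s)).symm
  refine ⟨u, hu0, fun s => ⟨(hu s).1.congr_deriv ?_, hQu s, (hu s).2⟩⟩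
  have e2 := projection_deriv_projection hQ hd s (u s)
  rw [hQu] at e2
  simp [hQu, e2]

end Family

section AnalyticTools

variable {E : Type*} [NormedAddCommGroup E] [NormedSpace ℝ E] {x : E}

/-- In complete spaces, analyticity is differentiability of order `ω`, so the closure properties of
`ContDiffAt` apply. Inner products and exponentials below are treated in the same way. -/
theorem analyticAt_real_clm_apply {F G : Type*} [NormedAddCommGroup F] [NormedSpace ℝ F]
    [NormedAddCommGroup G] [NormedSpace ℝ G] [CompleteSpace F] [CompleteSpace G]
    {A : E → F →L[ℝ] G} {v : E → F} (hA : AnalyticAt ℝ A x) (hv : AnalyticAt ℝ v x) :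
    AnalyticAt ℝ (fun y => A y (v y)) x :=
  (hA.contDiffAt.clm_apply hv.contDiffAt).analyticAt

theorem analyticAt_clm_apply {A : E → State n →L[ℂ] State n} {v : E → State n}
    (hA : AnalyticAt ℝ A x) (hv : AnalyticAt ℝ v x) : AnalyticAt ℝ (fun y => A y (v y)) x :=
  analyticAt_real_clm_apply (A := fun y => (A y).restrictScalars ℝ)
    (((ContinuousLinearMap.restrictScalarsL ℂ (State n) (State n) ℝ ℝ).analyticAt _).comp hA) hv

theorem analyticAt_inner {v w : E → State n} (hv : AnalyticAt ℝ v x) (hw : AnalyticAt ℝ w x) :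
    AnalyticAt ℝ (fun y => inner ℂ (v y) (w y)) x :=
  (hv.contDiffAt.inner ℂ hw.contDiffAt).analyticAt

theorem analyticAt_cexp_real {f : E → ℂ} (hf : AnalyticAt ℝ f x) :
    AnalyticAt ℝ (fun y => Complex.exp (f y)) x :=
  hf.contDiffAt.cexp.analyticAt

end AnalyticTools

section Joint

variable {Q : ℝ × ℝ → State n →L[ℂ] State n}

theorem hasDerivAt_snd_of_analytic (hQa : AnalyticOnNhd ℝ Q univ) (x s : ℝ) :
    HasDerivAt (fun s => Q (x, s)) (fderiv ℝ Q (x, s) (0, 1)) s := by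
  have h2 : HasDerivAt (fun s : ℝ => (x, s)) ((0 : ℝ), (1 : ℝ)) s :=
    (hasDerivAt_const s x).prodMk (hasDerivAt_id s)
  exact ((hQa (x, s) trivial).differentiableAt.hasFDerivAt).comp_hasDerivAt s h2

/-- Local form of the analyticity of parallel transport. -/
theorem exists_pos_analyticAt_transport (hQa : AnalyticOnNhd ℝ Q univ)
    (hQ : ∀ p, IsRankOneProjection (Q p)) {u : ℝ × ℝ → State n}
    (hu : ∀ x s, HasDerivAt (fun s => u (x, s)) (fderiv ℝ Q (x, s) (0, 1) (u (x, s))) s)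
    (hQu : ∀ p, Q p (u p) = u p) (hun : ∀ p, ‖u p‖ = 1) (x₀ s₀ : ℝ) :
    ∃ ε > 0, ∀ s₁ ∈ Metric.ball s₀ ε, AnalyticAt ℝ (fun x => u (x, s₁)) x₀ →
      ∀ s ∈ Metric.ball s₀ ε, AnalyticAt ℝ u (x₀, s) := by
  set v : State n := u (x₀, s₀) with hv
  let Q₂ : ℝ × ℝ → State n →L[ℂ] State n := fun p => fderiv ℝ Q p (0, 1)
  have hQ₂a : AnalyticOnNhd ℝ Q₂ univ := fun p _ =>
    analyticAt_real_clm_apply (hQa p trivial).fderiv analyticAt_const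
  let d : ℝ × ℝ → ℂ := fun p => inner ℂ v (Q p v)
  have hda : AnalyticOnNhd ℝ d univ := fun p hp =>
    analyticAt_inner analyticAt_const (analyticAt_clm_apply (hQa p hp) analyticAt_const)
  -- The section `Q v` does not vanish near the base point, and its failure to be parallel is `Q Q₂
  -- v = g • Q v`. Multiplying it by `exp (-G)`, where `∂₂G = g`, makes it parallel.
  let g : ℝ × ℝ → ℂ := fun p => inner ℂ v (Q p (Q₂ p v)) / d p
  have hd0 : d (x₀, s₀) ≠ 0 := by
    simp [d, v, hQu, inner_self_eq_norm_sq_to_K, hun]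
  have hga : ∀ p, d p ≠ 0 → AnalyticAt ℝ g p := fun p hp =>
    (analyticAt_inner analyticAt_const (analyticAt_clm_apply (hQa p trivial)
      (analyticAt_clm_apply (hQ₂a p trivial) analyticAt_const))).div (hda p trivial) hp
  let G : ℝ × ℝ → ℂ := fun p => ∫ t in s₀..p.2, g (p.1, t)
  have hGa : AnalyticAt ℝ G (x₀, s₀) := (hga _ hd0).intervalIntegral_snd
  obtain ⟨ε, hε, hball⟩ := Metric.eventually_nhds_iff_ball.1
    (hGa.eventually_analyticAt.and ((hda _ trivial).continuousAt.eventually_ne hd0))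
  have hmem : ∀ x ∈ Metric.ball x₀ ε, ∀ s ∈ Metric.ball s₀ ε, (x, s) ∈ Metric.ball (x₀, s₀) ε := by
    intro x hx s hs
    rw [← ball_prod_same]
    exact ⟨hx, hs⟩
  refine ⟨ε, hε, fun s₁ hs₁ hs₁a s hs => ?_⟩
  have hGd : ∀ x ∈ Metric.ball x₀ ε, ∀ s ∈ Metric.ball s₀ ε,
      HasDerivAt (fun s => G (x, s)) (g (x, s)) s := by
    intro x hx s hs
    have hcont : ContinuousOn (fun t => g (x, t)) (Metric.ball s₀ ε) := fun t ht =>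
      ((hga (x, t) (hball _ (hmem x hx t ht)).2).continuousAt.comp
        (f := fun t : ℝ => (x, t)) (by fun_prop)).continuousWithinAt
    have hsub : uIcc s₀ s ⊆ Metric.ball s₀ ε :=
      ((convex_ball s₀ ε).ordConnected).uIcc_subset (Metric.mem_ball_self hε) hs
    refine intervalIntegral.integral_hasDerivAt_right
      ((hcont.mono hsub).intervalIntegrable) ?_ (hcont.continuousAt (Metric.isOpen_ball.mem_nhds hs))
    exact hcont.stronglyMeasurableAtFilter Metric.isOpen_ball s hs
  -- The scalar that matches the value at `s₁`. It is the only place where the initial values enter,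
  -- so analyticity in `x` at the single level `s₁` spreads to every level in the ball.
  let c : ℝ → ℂ := fun x => Complex.exp (G (x, s₁)) * (inner ℂ v (u (x, s₁)) / d (x, s₁))
  have hmain : ∀ x ∈ Metric.ball x₀ ε, ∀ s ∈ Metric.ball s₀ ε,
      u (x, s) = (c x * Complex.exp (-G (x, s))) • Q (x, s) v := by
    intro x hx s hs
    have hsol : ∀ s ∈ Metric.ball s₀ ε,
        HasDerivAt (fun s => (c x * Complex.exp (-G (x, s))) • Q (x, s) v)
          (Q₂ (x, s) ((c x * Complex.exp (-G (x, s))) • Q (x, s) v)) s := by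
      intro s hs
      have h1 : HasDerivAt (fun s => Q (x, s) v) (Q₂ (x, s) v) s :=
        ((ContinuousLinearMap.apply ℂ (State n) v).restrictScalars ℝ).hasFDerivAt.comp_hasDerivAt s
          (hasDerivAt_snd_of_analytic hQa x s)
      have h2 := (((hGd x hx s hs).neg.cexp).const_mul (c x)).smul h1
      refine h2.congr_deriv ?_
      have e1 := deriv_projection_apply (fun s => hQ (x, s))
        (hasDerivAt_snd_of_analytic hQa x) s v
      have e2 := (hQ (x, s)).apply_eq_smul (hball _ (hmem x hx s hs)).2 (Q₂ (x, s) v)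
      change Q₂ (x, s) (Q (x, s) v) + Q (x, s) (Q₂ (x, s) v) = Q₂ (x, s) v at e1
      rw [map_smul, ← e1, e2]
      simp only [g, d]
      module
    have hx' := hmem x hx s₁ hs₁
    have hQ₂c : Continuous fun s => Q₂ (x, s) :=
      (continuousOn_univ.mp hQ₂a.continuousOn).comp (by fun_prop)
    simp only [Real.ball_eq_Ioo s₀] at hs₁ hs hsol
    refine eqOn_Ioo_of_hasDerivAt_clm hQ₂c hs₁ (f := fun s => u (x, s))
      (fun t _ => hu x t) hsol ?_ hs
    have e3 := (hQ (x, s₁)).apply_eq_smul (hball _ hx').2 (u (x, s₁))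
    rw [hQu] at e3
    change u (x, s₁) = _
    simp only [c]
    rw [mul_right_comm, ← Complex.exp_add, add_neg_cancel, Complex.exp_zero, one_mul]
    exact e3
  have hca : AnalyticAt ℝ c x₀ := by
    have hi : AnalyticAt ℝ (fun x : ℝ => (x, s₁)) x₀ := analyticAt_id.prod analyticAt_const
    have h := hball _ (hmem x₀ (Metric.mem_ball_self hε) s₁ hs₁)
    refine AnalyticAt.mul ?_ ((analyticAt_inner analyticAt_const hs₁a).div ?_ h.2)
    · exact analyticAt_cexp_real (AnalyticAt.comp (g := G) (f := fun x : ℝ => (x, s₁)) h.1 hi)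
    · exact AnalyticAt.comp (g := d) (f := fun x : ℝ => (x, s₁)) (hda _ trivial) hi
  have h := hball _ (hmem x₀ (Metric.mem_ball_self hε) s hs)
  have hfin : AnalyticAt ℝ (fun p : ℝ × ℝ => (c p.1 * Complex.exp (-G p)) • Q p v) (x₀, s) := by
    refine AnalyticAt.smul (AnalyticAt.mul ?_ (analyticAt_cexp_real h.1.neg))
      (analyticAt_clm_apply (hQa _ trivial) analyticAt_const)
    exact AnalyticAt.comp (g := c) (f := fun p : ℝ × ℝ => p.1) hca analyticAt_fst
  refine hfin.congr ?_
  filter_upwards [prod_mem_nhds (Metric.isOpen_ball.mem_nhds (Metric.mem_ball_self hε))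
    (Metric.isOpen_ball.mem_nhds hs)] with p hp
  exact (hmain p.1 hp.1 p.2 hp.2).symm

/-- Parallel transport from an analytic curve of initial values is jointly analytic. -/
theorem analyticOnNhd_transport (hQa : AnalyticOnNhd ℝ Q univ)
    (hQ : ∀ p, IsRankOneProjection (Q p)) {u : ℝ × ℝ → State n}
    (hu : ∀ x s, HasDerivAt (fun s => u (x, s)) (fderiv ℝ Q (x, s) (0, 1) (u (x, s))) s)
    (hQu : ∀ p, Q p (u p) = u p) (hun : ∀ p, ‖u p‖ = 1) {s₀ : ℝ}
    (hini : AnalyticOnNhd ℝ (fun x => u (x, s₀)) univ) : AnalyticOnNhd ℝ u univ := by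
  rintro ⟨x₀, s⟩ -
  have hloc := exists_pos_analyticAt_transport hQa hQ hu hQu hun x₀
  have hslice : ∀ s, AnalyticAt ℝ u (x₀, s) → AnalyticAt ℝ (fun x => u (x, s)) x₀ := fun s h =>
    AnalyticAt.comp (g := u) (f := fun x : ℝ => (x, s)) h (analyticAt_id.prod analyticAt_const)
  -- The radius `ε` serves every starting level `s₁` in the ball. This gives openness both of the
  -- set and of its complement.
  have hclopen : IsClopen {s | AnalyticAt ℝ (fun x => u (x, s)) x₀} := by
    refine ⟨⟨?_⟩, ?_⟩ <;> rw [Metric.isOpen_iff]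
    · intro s hs
      obtain ⟨ε, hε, h⟩ := hloc s
      exact ⟨ε, hε, fun s₁ hs₁ hs₁a =>
        hs (hslice _ (h s₁ hs₁ hs₁a s (Metric.mem_ball_self hε)))⟩
    · intro s hs
      obtain ⟨ε, hε, h⟩ := hloc s
      exact ⟨ε, hε, fun s₁ hs₁ => hslice _ (h s (Metric.mem_ball_self hε) hs s₁ hs₁)⟩
  have huniv := hclopen.eq_univ ⟨s₀, hini x₀ trivial⟩
  have hs : AnalyticAt ℝ (fun x => u (x, s)) x₀ := (huniv ▸ mem_univ s :)
  obtain ⟨ε, hε, h⟩ := hloc s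
  exact h s (Metric.mem_ball_self hε) hs s (Metric.mem_ball_self hε)

end Joint

end MatrixModel

end

/-! ### Analyticity and periodicity of a simple band -/

section

open MeasureTheory Filter Topology Set
open scoped ENNReal NNReal Nat ContDiff

namespace MatrixModel
variable {n : ℕ}

/-- Near a simple eigenvalue of an analytic family which is symmetric at the base point, the
eigenvalue and an eigenvector are analytic functions of the parameter. -/
theorem exists_analyticAt_eigenvalue {X : Type*} [NormedAddCommGroup X] [NormedSpace ℝ X]
    [CompleteSpace X] {T : X → State n →L[ℂ] State n} {x₀ : X} (hT : AnalyticAt ℝ T x₀)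
    (hsym : ∀ x y, inner ℂ (T x₀ x) y = inner ℂ x (T x₀ y)) {l₀ : ℝ} {v : State n} (hv : ‖v‖ = 1)
    (hTv : T x₀ v = (l₀ : ℂ) • v) (hsimple : ∀ x, T x₀ x = (l₀ : ℂ) • x → ∃ c : ℂ, x = c • v) :
    ∃ (e : X → ℝ) (w : X → State n), AnalyticAt ℝ e x₀ ∧ AnalyticAt ℝ w x₀ ∧
      ∀ᶠ p : X × ℝ in 𝓝 (x₀, l₀), ∀ u, u ≠ 0 → T p.1 u = (p.2 : ℂ) • u →
        p.2 = e p.1 ∧ ∃ c : ℂ, u = c • w p.1 := by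
  have hvv : inner ℂ v v = (1 : ℂ) := by simp [inner_self_eq_norm_sq_to_K, hv]
  let N : State n →L[ℂ] State n := (innerSL ℂ v).smulRight v
  have hN : ∀ x, N x = inner ℂ v x • v := fun x => rfl
  -- Bordering: adding the projection onto `v` removes the kernel of `T x₀ - l₀`. An eigenvector `u`
  -- of `T x` for `l` satisfies `B u = ⟪v, u⟫ v`, so it is a multiple of `W = B⁻¹ v`, and pairing
  -- with `v` forces `⟪v, W⟫ = 1`.
  let B : X × ℝ → State n →L[ℂ] State n := fun p => T p.1 - (p.2 : ℂ) • 1 + N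
  have hB : ∀ p x, B p x = T p.1 x - (p.2 : ℂ) • x + inner ℂ v x • v := fun p x => rfl
  have hBa : AnalyticAt ℝ B (x₀, l₀) := by
    refine (AnalyticAt.sub ?_ ?_).add analyticAt_const
    · exact AnalyticAt.comp (g := T) (f := fun p : X × ℝ => p.1) hT analyticAt_fst
    · exact ((Complex.ofRealCLM.analyticAt _).comp analyticAt_snd).smul analyticAt_const
  have hunit : IsUnit (B (x₀, l₀)) := by
    have hinj : Function.Injective (B (x₀, l₀)) := by
      rw [injective_iff_map_eq_zero]
      intro x hx
      rw [hB] at hx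
      dsimp only at hx
      have h1 : inner ℂ v (T x₀ x - (l₀ : ℂ) • x) = 0 := by
        rw [inner_sub_right, ← hsym, hTv, inner_smul_left, inner_smul_right]
        simp
      have h2 : inner ℂ v x = (0 : ℂ) := by
        have := congrArg (inner ℂ v) hx
        rw [inner_add_right, h1, zero_add, inner_smul_right, hvv, mul_one, inner_zero_right] at this
        exact this
      rw [h2, zero_smul, add_zero, sub_eq_zero] at hx
      obtain ⟨c, rfl⟩ := hsimple x hx
      rw [inner_smul_right, hvv, mul_one] at h2
      rw [h2, zero_smul]
    rw [ContinuousLinearMap.isUnit_iff_bijective]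
    exact ⟨hinj, (LinearMap.injective_iff_surjective (f := (B (x₀, l₀)).toLinearMap)).1 hinj⟩
  have hinva : AnalyticAt ℝ (fun p => Ring.inverse (B p)) (x₀, l₀) := by
    have h := analyticAt_inverse (𝕜 := ℝ) hunit.unit
    exact AnalyticAt.comp (g := Ring.inverse) h hBa
  let W : X × ℝ → State n := fun p => Ring.inverse (B p) v
  have hWa : AnalyticAt ℝ W (x₀, l₀) := analyticAt_clm_apply hinva analyticAt_const
  have hev : ∀ᶠ p in 𝓝 (x₀, l₀), IsUnit (B p) :=
    hBa.continuousAt.eventually (Units.isOpen.mem_nhds hunit)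
  have hWeq : ∀ p, IsUnit (B p) → ∀ (u : State n) (c : ℂ), B p u = c • v → u = c • W p := by
    intro p hp u c hu
    have h1 : Ring.inverse (B p) (B p u) = u :=
      DFunLike.congr_fun (Ring.inverse_mul_cancel _ hp) u
    rw [← h1, hu, map_smul]
  -- Eigenvalues near `l₀` lie on the level set `F = 1`. The real part makes this one real equation
  -- for the real unknown `l`, to be solved by the implicit function theorem.
  let F : X × ℝ → ℝ := fun p => (inner ℂ v (W p)).re
  have hFa : AnalyticAt ℝ F (x₀, l₀) :=
    (Complex.reCLM.analyticAt _).comp (analyticAt_inner analyticAt_const hWa)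
  have hFeig : ∀ p, IsUnit (B p) → ∀ u, u ≠ 0 → T p.1 u = (p.2 : ℂ) • u →
      F p = 1 ∧ u = (inner ℂ v u : ℂ) • W p := by
    intro p hp u hu0 hu
    have h1 : B p u = (inner ℂ v u : ℂ) • v := by rw [hB, hu, sub_self, zero_add]
    have h2 := hWeq p hp u _ h1
    refine ⟨?_, h2⟩
    have h3 : (inner ℂ v u : ℂ) ≠ 0 := by
      intro h0
      rw [h0, zero_smul] at h2
      exact hu0 h2
    have h4 := congrArg (inner ℂ v) h2
    rw [inner_smul_right] at h4
    have h5 : (inner ℂ v (W p) : ℂ) = 1 := by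
      refine mul_left_cancel₀ h3 ?_
      rw [← h4, mul_one]
    simp [F, h5]
  have hF0 : F (x₀, l₀) = 1 :=
    (hFeig _ hunit v (by rintro rfl; simp at hv) hTv).1
  -- Nondegeneracy in `l`: since `B (x₀, l) v = (1 + l₀ - l) v`, the function `F (x₀, ·)` is
  -- explicitly `(1 + l₀ - l)⁻¹` near `l₀`.
  have hFline : HasDerivAt (fun l : ℝ => F (x₀, l)) 1 l₀ := by
    have h1 : (fun l : ℝ => F (x₀, l)) =ᶠ[𝓝 l₀] fun l => (1 + l₀ - l)⁻¹ := by
      have hc : Tendsto (fun l : ℝ => (x₀, l)) (𝓝 l₀) (𝓝 (x₀, l₀)) :=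
        Continuous.tendsto (by fun_prop) _
      have hne : ∀ᶠ l in 𝓝 l₀, 1 + l₀ - l ≠ 0 :=
        ContinuousAt.eventually_ne (g := fun l : ℝ => 1 + l₀ - l) (by fun_prop) (by simp)
      filter_upwards [hc.eventually hev, hne] with l hl hl0
      have h2 : B (x₀, l) v = ((1 + l₀ - l : ℝ) : ℂ) • v := by
        rw [hB]
        dsimp only
        rw [hTv, hvv]
        push_cast
        module
      have h3 := hWeq _ hl v _ h2
      have h4 := congrArg (inner ℂ v) h3
      rw [inner_smul_right, hvv] at h4
      have h5 : (inner ℂ v (W (x₀, l)) : ℂ) = ((1 + l₀ - l)⁻¹ : ℝ) := by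
        rw [Complex.ofReal_inv]
        exact eq_inv_of_mul_eq_one_right h4.symm
      simp only [F]
      rw [h5, Complex.ofReal_re]
    have h2 : HasDerivAt (fun l : ℝ => (1 + l₀ - l)⁻¹) 1 l₀ := by
      have := ((hasDerivAt_const l₀ (1 + l₀)).sub (hasDerivAt_id l₀)).inv (by simp)
      simpa using! this
    exact h2.congr_of_eventuallyEq h1
  have hcd : ContDiffAt ℝ ω F (x₀, l₀) := hFa.contDiffAt
  have hinv : (fderiv ℝ F (x₀, l₀) ∘L .inr ℝ X ℝ).IsInvertible := by
    refine ⟨ContinuousLinearEquiv.refl ℝ ℝ, ?_⟩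
    have h1 : HasDerivAt (fun l : ℝ => (x₀, l)) ((0 : X), (1 : ℝ)) l₀ :=
      (hasDerivAt_const l₀ x₀).prodMk (hasDerivAt_id l₀)
    have h2 := hFa.differentiableAt.hasFDerivAt.comp_hasDerivAt l₀ h1
    have h3 := h2.unique hFline
    ext
    simp [h3]
  refine ⟨hcd.implicitFunction (by simp) hinv, fun x => W (x, hcd.implicitFunction (by simp) hinv x),
    (hcd.contDiffAt_implicitFunction (by simp) hinv).analyticAt, ?_, ?_⟩
  · have h0 : hcd.implicitFunction (by simp) hinv x₀ = l₀ :=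
      hcd.implicitFunction_apply_self (by simp) hinv
    have h1 : AnalyticAt ℝ (fun x => (x, hcd.implicitFunction (by simp) hinv x)) x₀ :=
      analyticAt_id.prod (hcd.contDiffAt_implicitFunction (by simp) hinv).analyticAt
    exact AnalyticAt.comp (g := W) (by rw [h0]; exact hWa) h1
  · filter_upwards [hev, hcd.eventually_apply_eq_iff_implicitFunction (by simp) hinv]
      with p hp hiff u hu0 hu
    obtain ⟨h1, h2⟩ := hFeig p hp u hu0 hu
    have h3 := hiff.1 (h1.trans hF0.symm)
    refine ⟨h3.symm, inner ℂ v u, ?_⟩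
    rw [h3]
    exact h2

/-- An operator-valued function is analytic if it is pointwise analytic. -/
theorem analyticAt_clm_of_apply {X : Type*} [NormedAddCommGroup X] [NormedSpace ℝ X]
    {A : X → State n →L[ℂ] State n} {x₀ : X} (h : ∀ v, AnalyticAt ℝ (fun x => A x v) x₀) :
    AnalyticAt ℝ A x₀ := by
  have hA : A = fun x => ∑ i, ContinuousLinearMap.smulRightL ℂ (State n) (State n)
      (innerSL ℂ (EuclideanSpace.single i (1 : ℂ))) (A x (EuclideanSpace.single i 1)) := by
    funext x
    ext1 v
    have hv : v = ∑ i, v i • EuclideanSpace.single i (1 : ℂ) := by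
      ext j
      simp [Finset.sum_apply, Pi.single_apply]
    conv_lhs => rw [hv]
    simp only [map_sum, map_smul]
    simp [EuclideanSpace.inner_single_left]
  rw [hA]
  refine Finset.analyticAt_fun_sum _ fun i _ => ?_
  exact (((ContinuousLinearMap.smulRightL ℂ (State n) (State n)
    (innerSL ℂ (EuclideanSpace.single i (1 : ℂ)))).restrictScalars ℝ).analyticAt _).comp (h _)

section Band

variable {H : Plane → Matrix (Fin n) (Fin n) ℂ} {E : Plane → ℝ}

/-- The Hamiltonian matrix as an operator. -/
noncomputable def hamiltonian (H : Plane → Matrix (Fin n) (Fin n) ℂ) (k : Plane) : State n →L[ℂ] State n :=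
  LinearMap.toContinuousLinearMap (Matrix.toEuclideanLin (H k))

theorem mem_bandSpace_iff {k : Plane} {v : State n} :
    v ∈ bandSpace H E k ↔ hamiltonian H k v = (E k : ℂ) • v :=
  Module.End.mem_eigenspace_iff

theorem analyticOnNhd_hamiltonian (hH : ∀ i j, AnalyticOnNhd ℝ (fun k => H k i j) univ) :
    AnalyticOnNhd ℝ (hamiltonian H) univ := by
  intro k _
  refine analyticAt_clm_of_apply fun v => ContDiffAt.analyticAt ?_
  rw [contDiffAt_piLp]
  intro i
  have : (fun k => hamiltonian H k v i) = fun k => ∑ j, H k i j * v j := by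
    funext k
    simp [hamiltonian, Matrix.mulVec, dotProduct]
  rw [this]
  exact ContDiffAt.sum fun j _ => ((hH i j k trivial).contDiffAt).mul contDiffAt_const

theorem hamiltonian_inner_left (hH : ∀ k, (H k).IsHermitian) (k : Plane) (x y : State n) :
    inner ℂ (hamiltonian H k x) y = inner ℂ x (hamiltonian H k y) :=
  Matrix.isSymmetric_toEuclideanLin_iff.2 (hH k) x y

theorem exists_unit_bandSpace (hE : ∀ k, Module.finrank ℂ (bandSpace H E k) = 1) (k : Plane) :
    ∃ w : State n, ‖w‖ = 1 ∧ bandSpace H E k = Submodule.span ℂ {w} := by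
  obtain ⟨v, hv0, hv⟩ := finrank_eq_one_iff'.1 (hE k)
  have hv0' : (v : State n) ≠ 0 := by simpa using hv0
  have hn : (‖(v : State n)‖ : ℂ) ≠ 0 := by simpa using hv0'
  refine ⟨((‖(v : State n)‖ : ℂ)⁻¹) • (v : State n), ?_, ?_⟩
  · rw [norm_smul, norm_inv, Complex.norm_real, norm_norm, inv_mul_cancel₀ (by simpa using hv0')]
  · rw [Submodule.span_singleton_smul_eq (by simpa using hv0')]
    refine le_antisymm (fun x hx => ?_) ?_
    · obtain ⟨c, hc⟩ := hv ⟨x, hx⟩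
      exact Submodule.mem_span_singleton.2 ⟨c, congrArg Subtype.val hc⟩
    · rw [Submodule.span_singleton_le_iff_mem]
      exact v.2

theorem isRankOneProjection_bandProjector (hE : ∀ k, Module.finrank ℂ (bandSpace H E k) = 1)
    (k : Plane) : IsRankOneProjection (bandProjector H E k) := by
  obtain ⟨w, hw, hs⟩ := exists_unit_bandSpace hE k
  refine ⟨w, hw, fun v => ?_⟩
  simp only [bandProjector, hs]
  exact Submodule.starProjection_unit_singleton ℂ hw v

theorem bandProjector_eq_self_iff {k : Plane} {v : State n} :
    bandProjector H E k v = v ↔ v ∈ bandSpace H E k :=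
  Submodule.starProjection_eq_self_iff

theorem exists_analyticAt_band (hH_herm : ∀ k, (H k).IsHermitian)
    (hH : ∀ i j, AnalyticOnNhd ℝ (fun k => H k i j) univ)
    (hE : ∀ k, Module.finrank ℂ (bandSpace H E k) = 1) (k₀ : Plane) :
    ∃ (e : Plane → ℝ) (w : Plane → State n), AnalyticAt ℝ e k₀ ∧ AnalyticAt ℝ w k₀ ∧
      ∀ᶠ p : Plane × ℝ in 𝓝 (k₀, E k₀), ∀ u, u ≠ 0 → hamiltonian H p.1 u = (p.2 : ℂ) • u →
        p.2 = e p.1 ∧ ∃ c : ℂ, u = c • w p.1 := by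
  obtain ⟨v, hv, hs⟩ := exists_unit_bandSpace hE k₀
  refine exists_analyticAt_eigenvalue (analyticOnNhd_hamiltonian hH k₀ trivial)
    (hamiltonian_inner_left hH_herm k₀) hv ?_ ?_
  · rw [← mem_bandSpace_iff, hs]
    exact Submodule.mem_span_singleton_self v
  · intro x hx
    rw [← mem_bandSpace_iff, hs] at hx
    obtain ⟨c, hc⟩ := Submodule.mem_span_singleton.1 hx
    exact ⟨c, hc.symm⟩

theorem exists_norm_eq_one_mem_bandSpace (hE : ∀ k, Module.finrank ℂ (bandSpace H E k) = 1)
    (k : Plane) : ∃ w : State n, ‖w‖ = 1 ∧ hamiltonian H k w = (E k : ℂ) • w := by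
  obtain ⟨w, hw, hs⟩ := exists_unit_bandSpace hE k
  refine ⟨w, hw, ?_⟩
  rw [← mem_bandSpace_iff, hs]
  exact Submodule.mem_span_singleton_self w

/-- The spectral projector of a simple band of an analytic Hermitian family is analytic. -/
theorem analyticOnNhd_bandProjector (hH_herm : ∀ k, (H k).IsHermitian)
    (hH : ∀ i j, AnalyticOnNhd ℝ (fun k => H k i j) univ) (hE_cont : Continuous E)
    (hE : ∀ k, Module.finrank ℂ (bandSpace H E k) = 1) :
    AnalyticOnNhd ℝ (bandProjector H E) univ := by
  intro k₀ _
  obtain ⟨e, w, -, hw, hev⟩ := exists_analyticAt_band hH_herm hH hE k₀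
  have hcont : Tendsto (fun k => (k, E k)) (𝓝 k₀) (𝓝 (k₀, E k₀)) :=
    Continuous.tendsto (by fun_prop) _
  -- The analytic eigenvector `w` is not normalized; dividing by `⟪w, w⟫` accounts for this.
  have hev2 : ∀ᶠ k in 𝓝 k₀, w k ≠ 0 ∧
      ∀ v, bandProjector H E k v = (inner ℂ (w k) v / inner ℂ (w k) (w k)) • w k := by
    filter_upwards [hcont.eventually hev] with k hk
    obtain ⟨u, hu, hHu⟩ := exists_norm_eq_one_mem_bandSpace hE k
    obtain ⟨-, c, hc⟩ := hk u (by rintro rfl; simp at hu) hHu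
    have hw0 : w k ≠ 0 := by
      intro h0
      simp [hc, h0] at hu
    have hc0 : c ≠ 0 := by
      intro h0
      simp [hc, h0] at hu
    refine ⟨hw0, fun v => ?_⟩
    have hu' : bandProjector H E k u = u := bandProjector_eq_self_iff.2 (mem_bandSpace_iff.2 hHu)
    rw [(isRankOneProjection_bandProjector hE k).apply_eq hu hu']
    have h1 : (starRingEnd ℂ) c * c * inner ℂ (w k) (w k) = 1 := by
      have h2 : (inner ℂ u u : ℂ) = 1 := by simp [inner_self_eq_norm_sq_to_K, hu]
      rw [hc, inner_smul_left, inner_smul_right, ← mul_assoc] at h2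
      exact h2
    have h3 : (inner ℂ (w k) (w k) : ℂ) ≠ 0 := inner_self_ne_zero.2 hw0
    rw [hc, inner_smul_left, smul_smul]
    congr 1
    rw [eq_div_iff h3]
    linear_combination (inner ℂ (w k) v) * h1
  refine analyticAt_clm_of_apply fun v => ?_
  have hA : AnalyticAt ℝ (fun k => (inner ℂ (w k) v / inner ℂ (w k) (w k) : ℂ) • w k) k₀ :=
    ((analyticAt_inner hw analyticAt_const).div (analyticAt_inner hw hw)
      (inner_self_ne_zero.2 hev2.self_of_nhds.1)).smul hw
  exact hA.congr (hev2.mono fun k hk => (hk.2 v).symm)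

/-- A continuous simple eigenvalue of a periodic Hermitian family is periodic. -/
theorem isLatticePeriodic_eigenvalue {b : Fin 2 → Plane} (hH_herm : ∀ k, (H k).IsHermitian)
    (hH : ∀ i j, AnalyticOnNhd ℝ (fun k => H k i j) univ) (hper : IsLatticePeriodic b H)
    (hE_cont : Continuous E) (hE : ∀ k, Module.finrank ℂ (bandSpace H E k) = 1) :
    IsLatticePeriodic b E := by
  intro k G hG
  have hHG : ∀ k, hamiltonian H (k + G) = hamiltonian H k := fun k => by
    simp only [hamiltonian, hper k G hG]
  have hcE : Continuous fun k => E (k + G) := hE_cont.comp (by fun_prop)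
  -- If the two values agree at `k₀`, then nearby both are eigenvalues of the same operator close to
  -- `E k₀`, where `e` is the only candidate.
  have hclopen : IsClopen {k | E (k + G) = E k} := by
    refine ⟨isClosed_eq hcE hE_cont, isOpen_iff_mem_nhds.2 fun k₀ hk₀ => ?_⟩
    obtain ⟨e, w, -, -, hev⟩ := exists_analyticAt_band hH_herm hH hE k₀
    have h1 : Tendsto (fun k => (k, E k)) (𝓝 k₀) (𝓝 (k₀, E k₀)) :=
      Continuous.tendsto (by fun_prop) _
    have h2 : Tendsto (fun k => (k, E (k + G))) (𝓝 k₀) (𝓝 (k₀, E k₀)) := by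
      have h := Continuous.tendsto (f := fun k => (k, E (k + G))) (by fun_prop) k₀
      rwa [show E (k₀ + G) = E k₀ from hk₀] at h
    filter_upwards [h1.eventually hev, h2.eventually hev] with k h1k h2k
    obtain ⟨u, hu, hHu⟩ := exists_norm_eq_one_mem_bandSpace hE k
    obtain ⟨u', hu', hHu'⟩ := exists_norm_eq_one_mem_bandSpace hE (k + G)
    rw [hHG] at hHu'
    have e1 := (h1k u (by rintro rfl; simp at hu) hHu).1
    have e2 := (h2k u' (by rintro rfl; simp at hu') hHu').1
    exact e2.trans e1.symm
  rcases isClopen_iff.1 hclopen with h | h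
  swap
  · exact (h ▸ mem_univ k :)
  exfalso
  -- In the remaining case the difference never vanishes, so it has constant sign, and `E (k + m G)`
  -- is a strictly monotone sequence of eigenvalues of the one operator `hamiltonian H k`.
  have hne : ∀ k, E (k + G) - E k ≠ 0 := by
    intro k h0
    have : k ∈ {k | E (k + G) = E k} := sub_eq_zero.1 h0
    rw [h] at this
    exact this
  have hsign : (∀ k, 0 < E (k + G) - E k) ∨ ∀ k, E (k + G) - E k < 0 := by
    by_contra! hcon
    obtain ⟨⟨k₁, h1⟩, k₂, h2⟩ := hcon
    obtain ⟨k, hk⟩ := mem_range_of_exists_le_of_exists_ge (hcE.sub hE_cont) ⟨k₁, h1⟩ ⟨k₂, h2⟩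
    exact hne k hk
  let f : ℕ → ℝ := fun m => E (k + (m : ℝ) • G)
  have hstep : ∀ m, f (m + 1) - f m = E (k + (m : ℝ) • G + G) - E (k + (m : ℝ) • G) := by
    intro m
    simp only [f]
    congr 2
    push_cast
    module
  have hinj : Function.Injective f := by
    rcases hsign with h | h
    · exact (strictMono_nat_of_lt_succ fun m => by linarith [hstep m, h (k + (m : ℝ) • G)]).injective
    · exact (strictAnti_nat_of_succ_lt fun m => by linarith [hstep m, h (k + (m : ℝ) • G)]).injective
  have hHm : ∀ m : ℕ, hamiltonian H (k + (m : ℝ) • G) = hamiltonian H k := by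
    intro m
    induction m with
    | zero => simp
    | succ m ih =>
      rw [← ih, ← hHG (k + (m : ℝ) • G)]
      congr 1
      push_cast
      module
  have heig : ∀ m, Module.End.HasEigenvalue (hamiltonian H k).toLinearMap (f m : ℂ) := by
    intro m
    obtain ⟨u, hu, hHu⟩ := exists_norm_eq_one_mem_bandSpace hE (k + (m : ℝ) • G)
    rw [hHm] at hHu
    exact Module.End.hasEigenvalue_of_hasEigenvector
      ⟨Module.End.mem_eigenspace_iff.2 hHu, by rintro rfl; simp at hu⟩
  have hfin : {μ : ℂ | Module.End.HasEigenvalue (hamiltonian H k).toLinearMap μ}.Finite :=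
    Module.End.finite_hasEigenvalue _
  refine Set.infinite_of_injective_forall_mem (f := fun m => (f m : ℂ)) ?_ heig hfin
  exact Complex.ofReal_injective.comp hinj

theorem isLatticePeriodic_bandProjector {b : Fin 2 → Plane} (hper : IsLatticePeriodic b H)
    (hE : IsLatticePeriodic b E) : IsLatticePeriodic b (bandProjector H E) := by
  intro k G hG
  simp only [bandProjector, bandSpace, hper k G hG, hE k G hG]

end Band

end MatrixModel

end

/-! ### Connection, curvature and the winding of the holonomy -/

section

open MeasureTheory Filter Topology Set
open scoped ENNReal NNReal Nat ContDiff

namespace MatrixModel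
variable {n : ℕ}

theorem hasDerivAt_fst_slice {F : Type*} [NormedAddCommGroup F] [NormedSpace ℝ F]
    {f : ℝ × ℝ → F} {x s : ℝ} (hf : DifferentiableAt ℝ f (x, s)) :
    HasDerivAt (fun x => f (x, s)) (fderiv ℝ f (x, s) (1, 0)) x :=
  hf.hasFDerivAt.comp_hasDerivAt x ((hasDerivAt_id x).prodMk (hasDerivAt_const x s))

theorem hasDerivAt_snd_slice {F : Type*} [NormedAddCommGroup F] [NormedSpace ℝ F]
    {f : ℝ × ℝ → F} {x s : ℝ} (hf : DifferentiableAt ℝ f (x, s)) :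
    HasDerivAt (fun s => f (x, s)) (fderiv ℝ f (x, s) (0, 1)) s :=
  hf.hasFDerivAt.comp_hasDerivAt s ((hasDerivAt_const s x).prodMk (hasDerivAt_id s))

theorem hasDerivAt_clm_apply {A : ℝ → State n →L[ℂ] State n} {A' : State n →L[ℂ] State n}
    {v : ℝ → State n} {v' : State n} {s : ℝ} (hA : HasDerivAt A A' s) (hv : HasDerivAt v v' s) :
    HasDerivAt (fun s => A s (v s)) (A' (v s) + A s v') s := by
  have h2 : HasDerivAt (fun s => (A s).restrictScalars ℝ) (A'.restrictScalars ℝ) s :=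
    (ContinuousLinearMap.restrictScalarsL ℂ (State n) (State n) ℝ ℝ).hasFDerivAt.comp_hasDerivAt
      s hA
  exact h2.clm_apply hv

theorem IsRankOneProjection.trace_mul {A : State n →L[ℂ] State n} (hA : IsRankOneProjection A)
    {v : State n} (hv : ‖v‖ = 1) (hAv : A v = v) (B : State n →L[ℂ] State n) :
    LinearMap.trace ℂ (State n) (A * B : State n →L[ℂ] State n) = inner ℂ v (B v) := by
  have : ((A * B : State n →L[ℂ] State n) : State n →ₗ[ℂ] State n) =
      ((innerSL ℂ v).toLinearMap ∘ₗ B.toLinearMap).smulRight v := by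
    ext1 x
    exact hA.apply_eq hv hAv (B x)
  rw [this, LinearMap.trace_smulRight]
  rfl

/-- The Berry curvature in the parameters `κ₁`, `κ₂`, without the factor `i`. -/
noncomputable def curvatureTrace (Q : ℝ × ℝ → State n →L[ℂ] State n) (p : ℝ × ℝ) : ℂ :=
  LinearMap.trace ℂ (State n) (Q p * (fderiv ℝ Q p (1, 0) * fderiv ℝ Q p (0, 1) -
    fderiv ℝ Q p (0, 1) * fderiv ℝ Q p (1, 0)) : State n →L[ℂ] State n)

/-- A unit section of a family of projections of rank one that is transported parallelly in the
second variable. -/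
structure IsTransportedSection (Q : ℝ × ℝ → State n →L[ℂ] State n) (u : ℝ × ℝ → State n) :
    Prop where
  hasDerivAt : ∀ x s, HasDerivAt (fun s => u (x, s)) (fderiv ℝ Q (x, s) (0, 1) (u (x, s))) s
  apply_eq : ∀ p, Q p (u p) = u p
  norm_eq : ∀ p, ‖u p‖ = 1
  analytic : AnalyticOnNhd ℝ u univ

namespace IsTransportedSection

variable {Q : ℝ × ℝ → State n →L[ℂ] State n} {u : ℝ × ℝ → State n}

/-- The connection coefficient `⟪u, ∂₁u⟫`. -/
noncomputable def connection (u : ℝ × ℝ → State n) (p : ℝ × ℝ) : ℂ :=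
  inner ℂ (u p) (fderiv ℝ u p (1, 0))

theorem fderiv_snd (hu : IsTransportedSection Q u) (p : ℝ × ℝ) :
    fderiv ℝ u p (0, 1) = fderiv ℝ Q p (0, 1) (u p) :=
  (hasDerivAt_snd_slice (x := p.1) (s := p.2) (hu.analytic p trivial).differentiableAt).unique
    (hu.hasDerivAt p.1 p.2)

theorem analytic_connection (hu : IsTransportedSection Q u) :
    AnalyticOnNhd ℝ (connection u) univ := fun p hp =>
  analyticAt_inner (hu.analytic p hp)
    (analyticAt_real_clm_apply (hu.analytic p hp).fderiv analyticAt_const)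

/-- Here `∂₂u = Q₂ u = Q₂ Q u`, and `Q Q₂ Q = 0`. -/
theorem apply_fderiv_snd (hQ : ∀ p, IsRankOneProjection (Q p)) (hQa : AnalyticOnNhd ℝ Q univ)
    (hu : IsTransportedSection Q u) (p : ℝ × ℝ) : Q p (fderiv ℝ u p (0, 1)) = 0 := by
  have h := projection_deriv_projection (fun s => hQ (p.1, s))
    (hasDerivAt_snd_of_analytic hQa p.1) p.2 (u p)
  rw [Prod.mk.eta, hu.apply_eq] at h
  rw [hu.fderiv_snd, h]

theorem inner_fderiv_snd (hQ : ∀ p, IsRankOneProjection (Q p)) (hQa : AnalyticOnNhd ℝ Q univ)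
    (hu : IsTransportedSection Q u) (p : ℝ × ℝ) : inner ℂ (u p) (fderiv ℝ u p (0, 1)) = (0 : ℂ) := by
  rw [← hu.apply_eq p, (hQ p).inner_left, apply_fderiv_snd hQ hQa hu, inner_zero_right]

/-- Differentiating the gauge condition `⟪u, ∂₂u⟫ = 0` in the first variable expresses `⟪u, ∂₁∂₂u⟫`
as `-⟪∂₁u, ∂₂u⟫`. With symmetry of second derivatives, the derivative of the connection is `⟪∂₂u,
∂₁u⟫ - ⟪∂₁u, ∂₂u⟫`. The trace is the opposite difference, since `Q₁ u = ∂₁u - Q ∂₁u`, `Q₂ u = ∂₂u`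
and `Q ∂₂u = 0`. -/
theorem hasDerivAt_connection (hQ : ∀ p, IsRankOneProjection (Q p))
    (hQa : AnalyticOnNhd ℝ Q univ) (hu : IsTransportedSection Q u) (x s : ℝ) :
    HasDerivAt (fun s => connection u (x, s)) (-curvatureTrace Q (x, s)) s := by
  have hua := hu.analytic (x, s) trivial
  have hud := hua.differentiableAt
  have hfd : DifferentiableAt ℝ (fderiv ℝ u) (x, s) := hua.fderiv.differentiableAt
  have h₁ : HasDerivAt (fun s => fderiv ℝ u (x, s) (1, 0))
      (fderiv ℝ (fderiv ℝ u) (x, s) (0, 1) (1, 0)) s := by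
    simpa using (hasDerivAt_snd_slice hfd).clm_apply (hasDerivAt_const s ((1 : ℝ), (0 : ℝ)))
  have h₂ : HasDerivAt (fun x => fderiv ℝ u (x, s) (0, 1))
      (fderiv ℝ (fderiv ℝ u) (x, s) (1, 0) (0, 1)) x := by
    simpa using (hasDerivAt_fst_slice hfd).clm_apply (hasDerivAt_const x ((0 : ℝ), (1 : ℝ)))
  have hsymm : fderiv ℝ (fderiv ℝ u) (x, s) (0, 1) (1, 0) =
      fderiv ℝ (fderiv ℝ u) (x, s) (1, 0) (0, 1) :=
    (ContDiffAt.isSymmSndFDerivAt_of_omega (𝕜 := ℝ) hua.contDiffAt) _ _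
  have hc := (hasDerivAt_snd_slice hud).inner ℂ h₁
  have hz := (hasDerivAt_fst_slice hud).inner ℂ h₂
  have hz0 : (fun x => inner ℂ (u (x, s)) (fderiv ℝ u (x, s) (0, 1))) = fun _ => (0 : ℂ) :=
    funext fun x => inner_fderiv_snd hQ hQa hu (x, s)
  rw [hz0] at hz
  have hzero := hz.unique (hasDerivAt_const x (0 : ℂ))
  refine hc.congr_deriv ?_
  set p : ℝ × ℝ := (x, s)
  set u₁ := fderiv ℝ u p (1, 0)
  set u₂ := fderiv ℝ u p (0, 1) with hu₂
  have hQ₁ : fderiv ℝ Q p (1, 0) (u p) = u₁ - Q p u₁ := by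
    have h := hasDerivAt_clm_apply (hasDerivAt_fst_slice (hQa (x, s) trivial).differentiableAt)
      (hasDerivAt_fst_slice hud)
    have h3 : (fun x => Q (x, s) (u (x, s))) = fun x => u (x, s) :=
      funext fun x => hu.apply_eq (x, s)
    rw [h3] at h
    exact eq_sub_of_add_eq (h.unique (hasDerivAt_fst_slice hud))
  have hQ₂ : fderiv ℝ Q p (0, 1) (u p) = u₂ := (hu.fderiv_snd p).symm
  have hQu₂ : Q p u₂ = 0 := apply_fderiv_snd hQ hQa hu p
  have hadj₁ : ∀ y z, inner ℂ (fderiv ℝ Q p (1, 0) y) z = inner ℂ y (fderiv ℝ Q p (1, 0) z) :=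
    inner_deriv_projection_left (Q := fun x => Q (x, s)) (Q' := fun x => fderiv ℝ Q (x, s) (1, 0))
      (fun x => hQ (x, s)) (fun x => hasDerivAt_fst_slice (hQa (x, s) trivial).differentiableAt) x
  have hadj₂ : ∀ y z, inner ℂ (fderiv ℝ Q p (0, 1) y) z = inner ℂ y (fderiv ℝ Q p (0, 1) z) :=
    inner_deriv_projection_left (fun s => hQ (x, s)) (hasDerivAt_snd_of_analytic hQa x) s
  have htr : curvatureTrace Q p = inner ℂ u₁ u₂ - inner ℂ u₂ u₁ := by
    rw [curvatureTrace, (hQ p).trace_mul (hu.norm_eq p) (hu.apply_eq p)]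
    change inner ℂ (u p) (fderiv ℝ Q p (1, 0) (fderiv ℝ Q p (0, 1) (u p)) -
      fderiv ℝ Q p (0, 1) (fderiv ℝ Q p (1, 0) (u p))) = _
    rw [inner_sub_right, ← hadj₁ (u p), ← hadj₂ (u p), hQ₁, hQ₂, inner_sub_left, inner_sub_right,
      (hQ p).inner_left, ← (hQ p).inner_left u₂, hQu₂, inner_zero_left, inner_zero_right]
    ring
  rw [htr, hsymm]
  linear_combination hzero

/-- The holonomy `z` satisfies `z' = f z`, where `f` is the difference of the connection at the two
ends, i.e. minus the integrated curvature trace. Integrating `f` gives an analytic phase, and its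
increment over a period is the total curvature, assumed zero. The initial value `c` is left free so
that the phase can later be matched with a prescribed branch. -/
theorem exists_periodic_phase (hQ : ∀ p, IsRankOneProjection (Q p))
    (hQa : AnalyticOnNhd ℝ Q univ) (hu : IsTransportedSection Q u)
    (hQper : ∀ x, Q (x, 1 / 2) = Q (x, -(1 / 2))) (huper : ∀ p, u (p + (1, 0)) = u p)
    (hC : ∫ x in (-(1 / 2) : ℝ)..(1 / 2), ∫ s in (-(1 / 2) : ℝ)..(1 / 2),
      curvatureTrace Q (x, s) = 0) {c : ℝ}
    (hc : u (-(1 / 2), 1 / 2) = Complex.exp (Complex.I * c) • u (-(1 / 2), -(1 / 2))) :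
    ∃ ψ : ℝ → ℝ, AnalyticOnNhd ℝ ψ univ ∧ ψ (-(1 / 2)) = c ∧ (∀ x, ψ (x + 1) = ψ x) ∧
      ∀ x, u (x, 1 / 2) = Complex.exp (Complex.I * ψ x) • u (x, -(1 / 2)) := by
  have hslice : ∀ s : ℝ, ∀ x, AnalyticAt ℝ (fun x => u (x, s)) x := fun s x =>
    AnalyticAt.comp (g := u) (f := fun x : ℝ => (x, s)) (hu.analytic _ trivial)
      (analyticAt_id.prod analyticAt_const)
  let f : ℝ → ℂ := fun x => connection u (x, 1 / 2) - connection u (x, -(1 / 2))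
  have hcon : ∀ s : ℝ, AnalyticOnNhd ℝ (fun x => connection u (x, s)) univ := fun s x _ =>
    AnalyticAt.comp (g := connection u) (f := fun x : ℝ => (x, s))
      (hu.analytic_connection _ trivial) (analyticAt_id.prod analyticAt_const)
  have hfa : AnalyticOnNhd ℝ f univ := fun x hx => (hcon _ x hx).sub (hcon _ x hx)
  -- Because `‖u‖ = 1`; this makes the phase real.
  have hre : ∀ p, (connection u p).re = 0 := by
    rintro ⟨x, s⟩
    have h := hasDerivAt_fst_slice (hu.analytic (x, s) trivial).differentiableAt
    have h1 := h.inner ℂ h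
    have h2 : (fun x => inner ℂ (u (x, s)) (u (x, s))) = fun _ => (1 : ℂ) := by
      funext x
      simp [inner_self_eq_norm_sq_to_K, hu.norm_eq]
    rw [h2] at h1
    have h3 := congrArg Complex.re (h1.unique (hasDerivAt_const x (1 : ℂ)))
    rw [← inner_conj_symm (fderiv ℝ u (x, s) (1, 0)) (u (x, s))] at h3
    simp only [Complex.add_re, Complex.conj_re, Complex.zero_re] at h3
    change (inner ℂ (u (x, s)) (fderiv ℝ u (x, s) (1, 0))).re = 0
    linarith
  have hfim : ∀ x, f x = (f x).im * Complex.I := by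
    intro x
    apply Complex.ext <;> simp [f, hre]
  have hfint : ∀ x, f x = -∫ s in (-(1 / 2) : ℝ)..(1 / 2), curvatureTrace Q (x, s) := by
    intro x
    have hcont : Continuous fun s => deriv (fun s => connection u (x, s)) s := by
      have : AnalyticOnNhd ℝ (fun s => connection u (x, s)) univ := fun s _ =>
        AnalyticAt.comp (g := connection u) (f := fun s : ℝ => (x, s))
          (hu.analytic_connection _ trivial) (analyticAt_const.prod analyticAt_id)
      exact continuousOn_univ.mp this.deriv.continuousOn
    have heq : (fun s => deriv (fun s => connection u (x, s)) s) =
        fun s => -curvatureTrace Q (x, s) :=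
      funext fun s => (hu.hasDerivAt_connection hQ hQa x s).deriv
    rw [heq] at hcont
    rw [← intervalIntegral.integral_neg]
    exact (intervalIntegral.integral_eq_sub_of_hasDerivAt
      (fun s _ => hu.hasDerivAt_connection hQ hQa x s) (hcont.intervalIntegrable _ _)).symm
  have hf0 : ∫ x in (-(1 / 2) : ℝ)..(1 / 2), f x = 0 := by
    simp_rw [hfint]
    rw [intervalIntegral.integral_neg, hC, neg_zero]
  let q : ℝ → ℝ := fun x => (f x).im
  have hqa : AnalyticOnNhd ℝ q univ := fun x hx => (Complex.imCLM.analyticAt _).comp (hfa x hx)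
  have hqc : Continuous q := continuousOn_univ.mp hqa.continuousOn
  have hfc : Continuous f := continuousOn_univ.mp hfa.continuousOn
  have hq0 : ∫ x in (-(1 / 2) : ℝ)..(1 / 2), q x = 0 := by
    have := Complex.imCLM.intervalIntegral_comp_comm (hfc.intervalIntegrable (μ := volume)
      (-(1 / 2)) (1 / 2))
    rw [hf0] at this
    simpa using! this
  have hconper : ∀ p, connection u (p + (1, 0)) = connection u p := by
    intro p
    have h1 : (fun p => u (p + (1, 0))) = u := funext huper
    have h2 : fderiv ℝ u (p + (1, 0)) = fderiv ℝ u p := by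
      rw [← fderiv_comp_add_right, h1]
    simp only [connection, h2, huper]
  have hqper : Function.Periodic q 1 := by
    intro x
    have h1 := hconper (x, 1 / 2)
    have h2 := hconper (x, -(1 / 2))
    simp only [Prod.mk_add_mk, add_zero] at h1 h2
    simp only [q, f, h1, h2]
  let ψ : ℝ → ℝ := fun x => c + ∫ t in (-(1 / 2) : ℝ)..x, q t
  have hψ0 : ψ (-(1 / 2)) = c := by simp [ψ]
  have hψd : ∀ x, HasDerivAt ψ (q x) x := fun x =>
    (intervalIntegral.integral_hasDerivAt_right (hqc.intervalIntegrable _ _)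
      hqc.stronglyMeasurable.stronglyMeasurableAtFilter hqc.continuousAt).const_add c
  let z : ℝ → ℂ := fun x => inner ℂ (u (x, -(1 / 2))) (u (x, 1 / 2))
  have hzu : ∀ x, u (x, 1 / 2) = z x • u (x, -(1 / 2)) := by
    intro x
    rw [← (hQ (x, -(1 / 2))).apply_eq (hu.norm_eq _) (hu.apply_eq _), ← hQper, hu.apply_eq]
  have hzn : ∀ x, (starRingEnd ℂ) (z x) * z x = 1 := by
    intro x
    have h1 : (inner ℂ (u (x, 1 / 2)) (u (x, 1 / 2)) : ℂ) = 1 := by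
      simp [inner_self_eq_norm_sq_to_K, hu.norm_eq]
    have h2 : (inner ℂ (u (x, -(1 / 2))) (u (x, -(1 / 2))) : ℂ) = 1 := by
      simp [inner_self_eq_norm_sq_to_K, hu.norm_eq]
    rwa [hzu x, inner_smul_left, inner_smul_right, h2, mul_one] at h1
  have hzd : ∀ x, HasDerivAt z (f x * z x) x := by
    intro x
    have hm := hasDerivAt_fst_slice (hu.analytic (x, -(1 / 2)) trivial).differentiableAt
    have hp := hasDerivAt_fst_slice (hu.analytic (x, 1 / 2) trivial).differentiableAt
    have h1 := hm.inner ℂ hp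
    have h2 := h1.smul hm
    have h3 : (fun x => z x • u (x, -(1 / 2))) = fun x => u (x, 1 / 2) :=
      funext fun x => (hzu x).symm
    change HasDerivAt (fun x => z x • u (x, -(1 / 2))) _ x at h2
    rw [h3] at h2
    have h4 := congrArg (inner ℂ (u (x, 1 / 2))) (h2.unique hp)
    refine h1.congr_deriv ?_
    set z' : ℂ := inner ℂ (u (x, -(1 / 2))) (fderiv ℝ u (x, 1 / 2) (1, 0)) +
      inner ℂ (fderiv ℝ u (x, -(1 / 2)) (1, 0)) (u (x, 1 / 2))
    have h5 : (inner ℂ (u (x, -(1 / 2))) (u (x, -(1 / 2))) : ℂ) = 1 := by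
      simp [inner_self_eq_norm_sq_to_K, hu.norm_eq]
    -- The derivative of `u (x, 1/2) = z x • u (x, -1/2)`, paired with `u (x, 1/2)`; together with
    -- `|z| = 1` it yields `z' = f z`.
    have h6 : (starRingEnd ℂ) (z x) * (z x * connection u (x, -(1 / 2)) + z') =
        connection u (x, 1 / 2) := by
      rw [connection, connection, ← h4]
      change _ = inner ℂ (u (x, 1 / 2)) (z x • fderiv ℝ u (x, -(1 / 2)) (1, 0) +
        z' • u (x, -(1 / 2)))
      rw [hzu x, inner_smul_left, inner_add_right, inner_smul_right, inner_smul_right, h5, mul_one]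
    have h7 := hzn x
    change z' = (connection u (x, 1 / 2) - connection u (x, -(1 / 2))) * z x
    rw [← h6]
    linear_combination (-(z x * connection u (x, -(1 / 2)) + z')) * h7
  have hexp : ∀ x, z x = Complex.exp (Complex.I * ψ x) := by
    have hd : ∀ x, HasDerivAt (fun x => z x * Complex.exp (-(Complex.I * ψ x))) 0 x := by
      intro x
      have h1 : HasDerivAt (fun x => -(Complex.I * (ψ x : ℂ))) (-(Complex.I * q x)) x :=
        ((hψd x).ofReal_comp.const_mul Complex.I).neg
      refine ((hzd x).mul h1.cexp).congr_deriv ?_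
      rw [hfim x]
      simp only [q]
      ring
    have hconst : ∀ x, z x * Complex.exp (-(Complex.I * ψ x)) = 1 := by
      intro x
      have h1 := is_const_of_deriv_eq_zero (fun x => (hd x).differentiableAt)
        (fun x => (hd x).deriv) x (-(1 / 2))
      refine h1.trans ?_
      have h2 : z (-(1 / 2)) = Complex.exp (Complex.I * c) := by
        have h5 : (inner ℂ (u (-(1 / 2), -(1 / 2))) (u (-(1 / 2), -(1 / 2))) : ℂ) = 1 := by
          simp [inner_self_eq_norm_sq_to_K, hu.norm_eq]
        simp only [z]
        rw [hc, inner_smul_right, h5, mul_one]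
      rw [h2, hψ0, ← Complex.exp_add, add_neg_cancel, Complex.exp_zero]
    intro x
    have h1 := hconst x
    rw [Complex.exp_neg, ← div_eq_mul_inv, div_eq_one_iff_eq (Complex.exp_ne_zero _)] at h1
    exact h1
  refine ⟨ψ, fun x hx => analyticAt_const.add (hqa.intervalIntegral _ x hx), hψ0, fun x => ?_,
    fun x => ?_⟩
  · have h1 := hqper.intervalIntegral_add_eq x (-(1 / 2))
    have h2 := intervalIntegral.integral_add_adjacent_intervals
      (hqc.intervalIntegrable (μ := volume) (-(1 / 2)) x) (hqc.intervalIntegrable x (x + 1))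
    rw [show (-(1 / 2) + 1 : ℝ) = 1 / 2 by norm_num, hq0] at h1
    rw [h1, add_zero] at h2
    simp only [ψ, h2]
  · rw [hzu, hexp]

end IsTransportedSection

end MatrixModel

end

/-! ### Lattice coordinates and the Chern number -/

section

open MeasureTheory Filter Topology Set
open scoped ENNReal NNReal Nat ContDiff

namespace MatrixModel
variable {n : ℕ}

section Coordinates

variable {a b : Fin 2 → Plane}

theorem inner_point_point (hab : IsReciprocal a b) (r₁ r₂ t₁ t₂ : ℝ) :
    inner ℝ (point a r₁ r₂) (point b t₁ t₂) = 2 * Real.pi * (r₁ * t₁ + r₂ * t₂) := by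
  simp only [point, inner_add_left, inner_add_right, inner_smul_left, inner_smul_right, hab _ _]
  simp
  ring

/-- The parametrization `(κ₁, κ₂) ↦ κ₁ b₁ + κ₂ b₂` as a linear map. -/
noncomputable def pointLinear (b : Fin 2 → Plane) : ℝ × ℝ →ₗ[ℝ] Plane :=
  (LinearMap.fst ℝ ℝ ℝ).smulRight (b 0) + (LinearMap.snd ℝ ℝ ℝ).smulRight (b 1)

@[simp]
theorem pointLinear_apply (b : Fin 2 → Plane) (p : ℝ × ℝ) : pointLinear b p = point b p.1 p.2 := rfl

theorem eq_vecCons_pair (c : Fin 2 → Plane) : c = ![c 0, c 1] := by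
  ext i : 1
  fin_cases i <;> rfl

theorem exists_pointEquiv_of_linearIndependent (ha : LinearIndependent ℝ a) :
    ∃ L : (ℝ × ℝ) ≃L[ℝ] Plane, ∀ p, L p = point a p.1 p.2 := by
  have hinj : Function.Injective (pointLinear a) := by
    rw [injective_iff_map_eq_zero]
    rintro ⟨s, t⟩ h
    have := LinearIndependent.pair_iff.1
      (show LinearIndependent ℝ ![a 0, a 1] by rwa [← eq_vecCons_pair]) s t h
    simp [this.1, this.2]
  exact ⟨((pointLinear a).linearEquivOfInjective hinj (by simp)).toContinuousLinearEquiv,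
    fun p => rfl⟩

theorem linearIndependent_of_isReciprocal (hab : IsReciprocal a b) : LinearIndependent ℝ b := by
  have hpi := Real.pi_pos.ne'
  have h : ∀ s t : ℝ, point b s t = 0 → s = 0 ∧ t = 0 := by
    intro s t h
    have h1 := inner_point_point hab 1 0 s t
    have h2 := inner_point_point hab 0 1 s t
    rw [h, inner_zero_right] at h1 h2
    constructor
    · simpa [hpi] using h1.symm
    · simpa [hpi] using h2.symm
  rw [eq_vecCons_pair b]
  exact LinearIndependent.pair_iff.2 h

/-- The constant is the Jacobian of the parametrization. Only its positivity matters later, so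
uniqueness of Haar measure replaces its computation. -/
theorem exists_pos_mul_setIntegral_cell (L : (ℝ × ℝ) ≃L[ℝ] Plane)
    (hL : ∀ p, L p = point b p.1 p.2) :
    ∃ c : ℝ, 0 < c ∧ ∀ F : Plane → ℂ, Continuous F →
      ∫ k in cell b, F k = c * ∫ x in (-(1 / 2) : ℝ)..(1 / 2), ∫ s in (-(1 / 2) : ℝ)..(1 / 2),
        F (point b x s) := by
  have hmap : ((volume : Measure (ℝ × ℝ)).map L).IsAddHaarMeasure := L.isAddHaarMeasure_map _
  set c : ℝ≥0 := Measure.addHaarScalarFactor (volume : Measure Plane) ((volume : Measure (ℝ × ℝ)).map L)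
  have hc : (volume : Measure Plane) = c • (volume : Measure (ℝ × ℝ)).map L :=
    Measure.isAddLeftInvariant_eq_smul _ _
  have hc0 : 0 < c := Measure.addHaarScalarFactor_pos_of_isAddHaarMeasure _ _
  refine ⟨c, hc0, fun F hF => ?_⟩
  have hcell : L ⁻¹' (cell b) = paramInterval ×ˢ paramInterval := by
    ext p
    simp only [mem_preimage, cell, mem_ofPred_eq, mem_prod]
    constructor
    · rintro ⟨s, hs, t, ht, h⟩
      have h2 : p = (s, t) := L.injective (by rw [h, hL])
      rw [h2]
      exact ⟨hs, ht⟩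
    · rintro ⟨h1, h2⟩
      exact ⟨_, h1, _, h2, hL p⟩
  have hLF : Continuous fun p => F (L p) := hF.comp L.continuous
  have h1 : ∫ k in cell b, F k = c * ∫ p in paramInterval ×ˢ paramInterval, F (L p) := by
    conv_lhs => rw [hc]
    rw [Measure.restrict_smul, integral_smul_nnreal_measure,
      (show MeasurableEmbedding L from L.toHomeomorph.measurableEmbedding).setIntegral_map, hcell]
    rfl
  rw [h1]
  congr 1
  rw [Measure.volume_eq_prod, setIntegral_prod]
  · simp only [paramInterval, integral_Icc_eq_integral_Ioc, hL]
    rw [intervalIntegral.integral_of_le (by norm_num)]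
    simp only [intervalIntegral.integral_of_le (show (-(1 / 2) : ℝ) ≤ 1 / 2 by norm_num)]
  · exact hLF.continuousOn.integrableOn_compact (isCompact_Icc.prod isCompact_Icc)

end Coordinates

section Curvature

theorem continuous_trace : Continuous fun A : State n →L[ℂ] State n =>
    LinearMap.trace ℂ (State n) (A : State n →ₗ[ℂ] State n) :=
  ((LinearMap.trace ℂ (State n)).comp
    (ContinuousLinearMap.coeLM ℂ (M := State n) (N₃ := State n))).continuous_of_finiteDimensional

theorem continuous_berryCurvature {P : Plane → State n →L[ℂ] State n}
    (hP : AnalyticOnNhd ℝ P univ) : Continuous (berryCurvature P) := by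
  have h1 : Continuous P := continuousOn_univ.mp hP.continuousOn
  have h2 : Continuous (fderiv ℝ P) := continuousOn_univ.mp hP.fderiv.continuousOn
  refine continuous_const.mul (continuous_trace.comp ?_)
  fun_prop

/-- The curvature is an alternating bilinear form in the two directions of differentiation, so
passing from `k_x, k_y` to `b₁, b₂` multiplies it by their determinant; `-i` undoes the factor `i`
of the Berry curvature. -/
theorem curvatureTrace_comp_point {P : Plane → State n →L[ℂ] State n}
    (hP : AnalyticOnNhd ℝ P univ) (b : Fin 2 → Plane) (p : ℝ × ℝ) :
    curvatureTrace (fun p => P (point b p.1 p.2)) p =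
      -Complex.I * (b 0 0 * b 1 1 - b 0 1 * b 1 0 : ℝ) * berryCurvature P (point b p.1 p.2) := by
  have hL : HasFDerivAt (fun p : ℝ × ℝ => point b p.1 p.2)
      (LinearMap.toContinuousLinearMap (pointLinear b)) p :=
    (LinearMap.toContinuousLinearMap (pointLinear b)).hasFDerivAt
  have hQ := ((hP (point b p.1 p.2) trivial).differentiableAt.hasFDerivAt.comp p hL).fderiv
  have hb : ∀ i, b i = b i 0 • EuclideanSpace.single 0 (1 : ℝ) +
      b i 1 • EuclideanSpace.single 1 (1 : ℝ) := by
    intro i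
    ext j
    fin_cases j <;> simp
  have h1 : fderiv ℝ (fun p : ℝ × ℝ => P (point b p.1 p.2)) p (1, 0) =
      fderiv ℝ P (point b p.1 p.2) (b 0) := by
    refine (DFunLike.congr_fun hQ _).trans ?_
    simp [point]
  have h2 : fderiv ℝ (fun p : ℝ × ℝ => P (point b p.1 p.2)) p (0, 1) =
      fderiv ℝ P (point b p.1 p.2) (b 1) := by
    refine (DFunLike.congr_fun hQ _).trans ?_
    simp [point]
  set X := fderiv ℝ P (point b p.1 p.2) (EuclideanSpace.single 0 1) with hX
  set Y := fderiv ℝ P (point b p.1 p.2) (EuclideanSpace.single 1 1) with hY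
  have h3 : ∀ i, fderiv ℝ P (point b p.1 p.2) (b i) = (b i 0 : ℂ) • X + (b i 1 : ℂ) • Y := by
    intro i
    conv_lhs => rw [hb i, map_add, map_smul, map_smul]
    rfl
  have h4 : P (point b p.1 p.2) * (((b 0 0 : ℂ) • X + (b 0 1 : ℂ) • Y) *
      ((b 1 0 : ℂ) • X + (b 1 1 : ℂ) • Y) - ((b 1 0 : ℂ) • X + (b 1 1 : ℂ) • Y) *
      ((b 0 0 : ℂ) • X + (b 0 1 : ℂ) • Y)) =
      ((b 0 0 * b 1 1 - b 0 1 * b 1 0 : ℝ) : ℂ) • (P (point b p.1 p.2) * (X * Y - Y * X)) := by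
    rw [← mul_smul_comm]
    congr 1
    simp only [add_mul, mul_add, smul_mul_assoc, mul_smul_comm]
    push_cast
    module
  rw [curvatureTrace, h1, h2, h3, h3, h4]
  change LinearMap.trace ℂ (State n) (_ • _) = _
  rw [map_smul, berryCurvature, ← hX, ← hY]
  linear_combination (((b 0 0 * b 1 1 - b 0 1 * b 1 0 : ℝ) : ℂ) * LinearMap.trace ℂ (State n)
    (P (point b p.1 p.2) * (X * Y - Y * X) : State n →L[ℂ] State n)) * Complex.I_sq

theorem integral_curvatureTrace_eq_zero {a b : Fin 2 → Plane} (hab : IsReciprocal a b)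
    {P : Plane → State n →L[ℂ] State n} (hP : AnalyticOnNhd ℝ P univ) (hC : chernNumber b P = 0) :
    ∫ x in (-(1 / 2) : ℝ)..(1 / 2), ∫ s in (-(1 / 2) : ℝ)..(1 / 2),
      curvatureTrace (fun p => P (point b p.1 p.2)) (x, s) = 0 := by
  obtain ⟨L, hL⟩ := exists_pointEquiv_of_linearIndependent (linearIndependent_of_isReciprocal hab)
  obtain ⟨c, hc, h⟩ := exists_pos_mul_setIntegral_cell L hL
  have h1 := h _ (continuous_berryCurvature hP)
  have hpi := Real.pi_pos.ne'
  rw [chernNumber, mul_eq_zero] at hC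
  have h2 : ∫ k in cell b, berryCurvature P k = 0 :=
    hC.resolve_left (by simp [hpi])
  rw [h2, eq_comm, mul_eq_zero] at h1
  have h3 := h1.resolve_left (by exact_mod_cast hc.ne')
  simp only [curvatureTrace_comp_point hP, intervalIntegral.integral_const_mul, h3, mul_zero]

end Curvature

end MatrixModel

end

/-! ### Global transport and its behaviour under periods -/

section

open MeasureTheory Filter Topology Set
open scoped ENNReal NNReal Nat ContDiff

namespace MatrixModel
variable {n : ℕ}

section Transport

variable {Q : ℝ × ℝ → State n →L[ℂ] State n}

theorem continuous_fderiv_slice {F : Type*} [NormedAddCommGroup F] [NormedSpace ℝ F]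
    [CompleteSpace F] {f : ℝ × ℝ → F} (hf : AnalyticOnNhd ℝ f univ) (e : ℝ × ℝ) :
    Continuous fun p => fderiv ℝ f p e :=
  (continuousOn_univ.mp hf.fderiv.continuousOn).clm_apply continuous_const

theorem exists_isTransportedSection (hQ : ∀ p, IsRankOneProjection (Q p))
    (hQa : AnalyticOnNhd ℝ Q univ) {v : ℝ → State n} (hv : AnalyticOnNhd ℝ v univ) {s₀ : ℝ}
    (hvn : ∀ x, ‖v x‖ = 1) (hQv : ∀ x, Q (x, s₀) (v x) = v x) :
    ∃ u, IsTransportedSection Q u ∧ ∀ x, u (x, s₀) = v x := by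
  choose w hw0 hw using fun x => exists_parallel_transport (fun s => hQ (x, s))
    (hasDerivAt_snd_of_analytic hQa x)
    ((continuous_fderiv_slice hQa (0, 1)).comp (f := fun s : ℝ => (x, s)) (by fun_prop)) s₀
    (hvn x) (hQv x)
  refine ⟨fun p => w p.1 p.2, ⟨fun x s => (hw x s).1, fun p => (hw p.1 p.2).2.1,
    fun p => (hw p.1 p.2).2.2, ?_⟩, hw0⟩
  refine analyticOnNhd_transport hQa hQ (fun x s => (hw x s).1) (fun p => (hw p.1 p.2).2.1)
    (fun p => (hw p.1 p.2).2.2) (s₀ := s₀) ?_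
  simpa only [hw0] using hv

/-- Parallel transport in the first variable along the line of constant second variable `s`. -/
theorem exists_transport_fst (hQ : ∀ p, IsRankOneProjection (Q p))
    (hQa : AnalyticOnNhd ℝ Q univ) {v : State n} {x₀ s : ℝ} (hv : ‖v‖ = 1)
    (hQv : Q (x₀, s) v = v) :
    ∃ u : ℝ → State n, u x₀ = v ∧ AnalyticOnNhd ℝ u univ ∧
      ∀ x, HasDerivAt u (fderiv ℝ Q (x, s) (1, 0) (u x)) x ∧ Q (x, s) (u x) = u x ∧ ‖u x‖ = 1 := by
  have hg : ∀ p : ℝ × ℝ, AnalyticAt ℝ (fun p : ℝ × ℝ => (p.2, s)) p := fun p =>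
    analyticAt_snd.prod analyticAt_const
  have hQa' : AnalyticOnNhd ℝ (fun p : ℝ × ℝ => Q (p.2, s)) univ := fun p _ =>
    AnalyticAt.comp (g := Q) (hQa _ trivial) (hg p)
  -- The two-variable result applied with a dummy first variable, the transport running in the
  -- second.
  obtain ⟨u, hu, hu0⟩ := exists_isTransportedSection (Q := fun p => Q (p.2, s))
    (fun p => hQ _) hQa' (v := fun _ => v) (s₀ := x₀) (fun _ _ => analyticAt_const) (fun _ => hv)
    (fun _ => hQv)
  refine ⟨fun x => u (0, x), hu0 0, fun x _ => AnalyticAt.comp (g := u) (f := fun x : ℝ => (0, x))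
    (hu.analytic _ trivial) (analyticAt_const.prod analyticAt_id),
    fun x => ⟨?_, hu.apply_eq (0, x), hu.norm_eq _⟩⟩
  have h1 : fderiv ℝ (fun p : ℝ × ℝ => Q (p.2, s)) (0, x) (0, 1) = fderiv ℝ Q (x, s) (1, 0) :=
    (hasDerivAt_snd_slice (hQa' (0, x) trivial).differentiableAt).unique
      (hasDerivAt_fst_slice (hQa (x, s) trivial).differentiableAt)
  rw [← h1]
  exact hu.hasDerivAt 0 x

theorem eq_of_hasDerivAt_clm {A : ℝ → State n →L[ℂ] State n} (hA : Continuous A) {t₀ : ℝ}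
    {f g : ℝ → State n} (hf : ∀ t, HasDerivAt f (A t (f t)) t)
    (hg : ∀ t, HasDerivAt g (A t (g t)) t) (h : f t₀ = g t₀) (t : ℝ) : f t = g t := by
  refine eqOn_Ioo_of_hasDerivAt_clm hA (a := min t t₀ - 1) (b := max t t₀ + 1) (t₀ := t₀)
    ⟨by linarith [min_le_right t t₀], by linarith [le_max_right t t₀]⟩
    (fun t _ => hf t) (fun t _ => hg t) h
    ⟨by linarith [min_le_left t t₀], by linarith [le_max_left t t₀]⟩

theorem fderiv_add_of_periodic {F : Type*} [NormedAddCommGroup F] [NormedSpace ℝ F]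
    {f : ℝ × ℝ → F} {e : ℝ × ℝ} (h : ∀ p, f (p + e) = f p) (p : ℝ × ℝ) :
    fderiv ℝ f (p + e) = fderiv ℝ f p := by
  have h1 : (fun p => f (p + e)) = f := funext h
  rw [← fderiv_comp_add_right, h1]

/-- Both sides solve the same linear equation, its coefficients being 1-periodic, and agree at `x₀`.
-/
theorem transport_fst_add_one (hQa : AnalyticOnNhd ℝ Q univ) (hper : ∀ p, Q (p + (1, 0)) = Q p)
    {u : ℝ → State n} {s x₀ : ℝ} {c : ℂ}
    (hu : ∀ x, HasDerivAt u (fderiv ℝ Q (x, s) (1, 0) (u x)) x)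
    (h : u (x₀ + 1) = c • u x₀) (x : ℝ) : u (x + 1) = c • u x := by
  refine eq_of_hasDerivAt_clm (A := fun x => fderiv ℝ Q (x, s) (1, 0))
    ((continuous_fderiv_slice hQa (1, 0)).comp (f := fun x : ℝ => (x, s)) (by fun_prop))
    (f := fun x => u (x + 1)) (g := fun x => c • u x) (fun x => ?_) (fun x => ?_) h x
  · have h1 := fderiv_add_of_periodic hper (x, s)
    simp only [Prod.mk_add_mk, add_zero] at h1
    rw [← h1]
    exact (hu (x + 1)).comp_add_const x 1
  · rw [map_smul]
    exact (hu x).const_smul c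

namespace IsTransportedSection

variable {u : ℝ × ℝ → State n}

theorem add_one_fst (hQa : AnalyticOnNhd ℝ Q univ) (hper : ∀ p, Q (p + (1, 0)) = Q p)
    (hu : IsTransportedSection Q u) {s₀ : ℝ} (h : ∀ x, u (x + 1, s₀) = u (x, s₀)) (p : ℝ × ℝ) :
    u (p + (1, 0)) = u p := by
  obtain ⟨x, s⟩ := p
  simp only [Prod.mk_add_mk, add_zero]
  refine eq_of_hasDerivAt_clm (A := fun s => fderiv ℝ Q (x, s) (0, 1))
    ((continuous_fderiv_slice hQa (0, 1)).comp (f := fun s : ℝ => (x, s)) (by fun_prop))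
    (f := fun s => u (x + 1, s)) (g := fun s => u (x, s)) (fun s => ?_) (hu.hasDerivAt x) (h x) s
  have h1 := fderiv_add_of_periodic hper (x, s)
  simp only [Prod.mk_add_mk, add_zero] at h1
  rw [← h1]
  exact hu.hasDerivAt (x + 1) s

/-- The factor `c x` does not involve the transport variable, so the relation at one level
propagates along it. This is what makes the linear correction of the phase in `s` periodic. -/
theorem add_one_snd (hQa : AnalyticOnNhd ℝ Q univ) (hper : ∀ p, Q (p + (0, 1)) = Q p)
    (hu : IsTransportedSection Q u) {s₀ : ℝ} {c : ℝ → ℂ}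
    (h : ∀ x, u (x, s₀ + 1) = c x • u (x, s₀)) (x s : ℝ) : u (x, s + 1) = c x • u (x, s) := by
  refine eq_of_hasDerivAt_clm (A := fun s => fderiv ℝ Q (x, s) (0, 1))
    ((continuous_fderiv_slice hQa (0, 1)).comp (f := fun s : ℝ => (x, s)) (by fun_prop))
    (f := fun s => u (x, s + 1)) (g := fun s => c x • u (x, s)) (fun s => ?_) (fun s => ?_) (h x) s
  · have h1 := fderiv_add_of_periodic hper (x, s)
    simp only [Prod.mk_add_mk, add_zero] at h1
    rw [← h1]
    exact (hu.hasDerivAt x (s + 1)).comp_add_const s 1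
  · rw [map_smul]
    exact (hu.hasDerivAt x s).const_smul (c x)

end IsTransportedSection

/-- A continuous branch of the phase on an interval is determined by its initial value. -/
theorem eqOn_of_cexp_eq {f g : ℝ → ℝ} {a b : ℝ} (hab : a ≤ b) (hf : ContinuousOn f (Icc a b))
    (hg : ContinuousOn g (Icc a b)) (ha : f a = g a)
    (h : ∀ x ∈ Icc a b, Complex.exp (Complex.I * f x) = Complex.exp (Complex.I * g x)) :
    EqOn f g (Icc a b) := by
  -- The difference is continuous on a connected set with values in the discrete group `2π ℤ`, hence
  -- constant.
  have hmem : MapsTo (fun x => f x - g x) (Icc a b)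
      (AddSubgroup.zmultiples (2 * Real.pi) : Set ℝ) := by
    intro x hx
    obtain ⟨m, hm⟩ := Complex.exp_eq_exp_iff_exists_int.1 (h x hx)
    refine ⟨m, ?_⟩
    have h1 : (f x : ℂ) = g x + m * (2 * Real.pi) := by
      have := mul_left_cancel₀ Complex.I_ne_zero
        (hm.trans (by ring : _ = Complex.I * (g x + m * (2 * Real.pi) : ℂ)))
      exact this
    have h2 : f x = g x + m * (2 * Real.pi) := by exact_mod_cast h1
    simp [h2]
  intro x hx
  have h1 := (isPreconnected_Icc (a := a) (b := b)).constant_of_mapsTo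
    (isDiscrete_iff_discreteTopology.2
      (inferInstanceAs (DiscreteTopology (AddSubgroup.zmultiples (2 * Real.pi)))))
    (f := fun x => f x - g x) (hf.sub hg) hmem hx (left_mem_Icc.2 hab)
  simp only [ha, sub_self] at h1
  exact sub_eq_zero.1 h1

end Transport

section Construction

variable {P : Plane → State n →L[ℂ] State n} {b : Fin 2 → Plane}

theorem point_add (b : Fin 2 → Plane) (x s x' s' : ℝ) :
    point b (x + x') (s + s') = point b x s + point b x' s' := by
  simp only [point]
  module

theorem point_intCast_mem_lattice (b : Fin 2 → Plane) (m₁ m₂ : ℤ) : point b m₁ m₂ ∈ lattice b :=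
  ⟨m₁, m₂, rfl⟩

theorem IsLatticePeriodic.add_one_fst {X : Type*} {f : Plane → X} (hper : IsLatticePeriodic b f)
    (p : ℝ × ℝ) : f (point b (p + (1, 0)).1 (p + (1, 0)).2) = f (point b p.1 p.2) := by
  have := hper (point b p.1 p.2) _ (point_intCast_mem_lattice b 1 0)
  rw [← point_add] at this
  simpa using this

theorem IsLatticePeriodic.add_one_snd {X : Type*} {f : Plane → X} (hper : IsLatticePeriodic b f)
    (p : ℝ × ℝ) : f (point b (p + (0, 1)).1 (p + (0, 1)).2) = f (point b p.1 p.2) := by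
  have := hper (point b p.1 p.2) _ (point_intCast_mem_lattice b 0 1)
  rw [← point_add] at this
  simpa using this

theorem analyticOnNhd_comp_point {F : Type*} [NormedAddCommGroup F] [NormedSpace ℝ F]
    {f : Plane → F} (hf : AnalyticOnNhd ℝ f univ) (b : Fin 2 → Plane) :
    AnalyticOnNhd ℝ (fun p : ℝ × ℝ => f (point b p.1 p.2)) univ := fun p _ =>
  AnalyticAt.comp (g := f) (f := fun p : ℝ × ℝ => point b p.1 p.2) (hf _ trivial)
    ((LinearMap.toContinuousLinearMap (pointLinear b)).analyticAt p)

/-- A global analytic version of the data of the two-stage construction. -/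
theorem exists_global_transport (hP : ∀ k, IsRankOneProjection (P k))
    (hPa : AnalyticOnNhd ℝ P univ) (hper : IsLatticePeriodic b P) {v₀ : State n} (hv₀ : ‖v₀‖ = 1)
    (hPv₀ : P (point b (-(1 / 2)) (-(1 / 2))) v₀ = v₀) :
    ∃ w : ℝ → State n, w (-(1 / 2)) = v₀ ∧
      (∀ x, HasDerivAt w (deriv (fun t => P (point b t (-(1 / 2)))) x (w x)) x) ∧
      (∃ θ : ℝ, w (1 / 2) = Complex.exp (Complex.I * θ) • w (-(1 / 2))) ∧
      ∀ θ : ℝ, w (1 / 2) = Complex.exp (Complex.I * θ) • w (-(1 / 2)) →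
        ∃ u : ℝ × ℝ → State n, IsTransportedSection (fun p => P (point b p.1 p.2)) u ∧
          (∀ x : ℝ, u (x, -(1 / 2)) = Complex.exp (-Complex.I * θ * (x + 1 / 2)) • w x) ∧
          ∀ p, u (p + (1, 0)) = u p := by
  set Q : ℝ × ℝ → State n →L[ℂ] State n := fun p => P (point b p.1 p.2) with hQdef
  have hQ : ∀ p, IsRankOneProjection (Q p) := fun p => hP _
  have hQa : AnalyticOnNhd ℝ Q univ := analyticOnNhd_comp_point hPa b
  have hQ₁ : ∀ p, Q (p + (1, 0)) = Q p := hper.add_one_fst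
  obtain ⟨w, hw0, hwa, hw⟩ := exists_transport_fst hQ hQa (x₀ := -(1 / 2)) (s := -(1 / 2)) hv₀ hPv₀
  -- The phase is determined only modulo `2π`; the last clause admits every choice of `θ`, because
  -- the construction may use any of them.
  refine ⟨w, hw0, fun x => ?_, ?_, fun θ hθ => ?_⟩
  · have h1 := (hasDerivAt_fst_slice (hQa (x, -(1 / 2)) trivial).differentiableAt).deriv
    simp only [hQdef] at h1 ⊢
    rw [h1]
    exact (hw x).1
  · have h1 := hQ₁ (-(1 / 2), -(1 / 2))
    norm_num at h1
    have h2 := (hw (1 / 2)).2.1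
    have h3 := (hw (-(1 / 2))).2.1
    norm_num at h2 h3
    rw [h1] at h2
    have h4 := (hQ _).exists_phase (hw (-(1 / 2))).2.2 (by norm_num; exact h3) (hw (1 / 2)).2.2
      (by norm_num; exact h2)
    exact h4
  -- The quasi-periodicity of `w` holds on the whole line, so `exp (-i θ (x + 1/2)) • w x` is
  -- 1-periodic.
  · have hw1 : ∀ x, w (x + 1) = Complex.exp (Complex.I * θ) • w x :=
      transport_fst_add_one hQa hQ₁ (s := -(1 / 2)) (x₀ := -(1 / 2)) (fun x => (hw x).1) (by
        rw [← hθ]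
        norm_num)
    let v : ℝ → State n := fun x => Complex.exp (-Complex.I * θ * (x + 1 / 2)) • w x
    have hva : AnalyticOnNhd ℝ v univ := by
      intro x _
      refine AnalyticAt.smul (analyticAt_cexp_real (analyticAt_const.mul
        (AnalyticAt.add ?_ analyticAt_const))) (hwa x trivial)
      exact Complex.ofRealCLM.analyticAt x
    have hen : ∀ x : ℝ, ‖Complex.exp (-Complex.I * θ * (x + 1 / 2))‖ = 1 := by
      intro x
      rw [← Complex.norm_exp_ofReal_mul_I (-(θ * (x + 1 / 2)))]
      congr 2
      push_cast
      ring
    obtain ⟨u, hu, hu0⟩ := exists_isTransportedSection hQ hQa hva (s₀ := -(1 / 2))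
      (fun x => by simp only [v, norm_smul, hen, (hw x).2.2, mul_one])
      (fun x => by simp only [v, map_smul, (hw x).2.1])
    refine ⟨u, hu, hu0, hu.add_one_fst hQa hQ₁ (s₀ := -(1 / 2)) fun x => ?_⟩
    rw [hu0, hu0]
    simp only [v, hw1, smul_smul, ← Complex.exp_add]
    congr 2
    push_cast
    ring

end Construction

end MatrixModel

end

/-! ### Exponential decay of Fourier coefficients and Wannier functions -/

section

open MeasureTheory Filter Topology Set
open scoped ENNReal NNReal ContDiff

namespace MatrixModel
variable {n : ℕ}

section Decay

theorem decaysExponentially_zero (S : Set Plane) :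
    DecaysExponentially S (fun _ => (0 : ℂ)) :=
  ⟨1, 1, one_pos, one_pos, fun r _ => by rw [norm_zero]; positivity⟩

theorem DecaysExponentially.add {S : Set Plane} {f g : Plane → ℂ} (hf : DecaysExponentially S f)
    (hg : DecaysExponentially S g) : DecaysExponentially S (fun r => f r + g r) := by
  obtain ⟨C, δ, hC, hδ, h⟩ := hf
  obtain ⟨C', δ', hC', hδ', h'⟩ := hg
  refine ⟨C + C', min δ δ', by positivity, lt_min hδ hδ', fun r hr => ?_⟩
  refine (norm_add_le _ _).trans ?_
  rw [add_mul]
  refine add_le_add ((h r hr).trans ?_) ((h' r hr).trans ?_)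
  · gcongr
    exact min_le_left _ _
  · gcongr
    exact min_le_right _ _

theorem decaysExponentially_sum {S : Set Plane} {ι : Type*} (s : Finset ι) {f : ι → Plane → ℂ}
    (hf : ∀ i, DecaysExponentially S (f i)) : DecaysExponentially S (fun r => ∑ i ∈ s, f i r) := by
  classical
  induction s using Finset.induction_on with
  | empty => simpa using decaysExponentially_zero S
  | insert i s hi ih =>
    simp only [Finset.sum_insert hi]
    exact (hf i).add ih

theorem exists_abs_add_abs_le_norm_point {a : Fin 2 → Plane} (ha : LinearIndependent ℝ a) :
    ∃ K : ℝ, 0 < K ∧ ∀ x s : ℝ, |x| + |s| ≤ K * ‖point a x s‖ := by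
  obtain ⟨L, hL⟩ := exists_pointEquiv_of_linearIndependent ha
  refine ⟨2 * ‖(L.symm : Plane →L[ℝ] ℝ × ℝ)‖ + 1, by positivity, fun x s => ?_⟩
  have h1 : ‖(x, s)‖ ≤ ‖(L.symm : Plane →L[ℝ] ℝ × ℝ)‖ * ‖point a x s‖ := by
    have := (L.symm : Plane →L[ℝ] ℝ × ℝ).le_opNorm (point a x s)
    rw [← hL (x, s)] at this ⊢
    simpa using this
  have h2 : |x| ≤ ‖(x, s)‖ := norm_fst_le (x, s)
  have h3 : |s| ≤ ‖(x, s)‖ := norm_snd_le (x, s)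
  have h4 := norm_nonneg (point a x s)
  nlinarith

theorem norm_point_le (a : Fin 2 → Plane) (x s : ℝ) :
    ‖point a x s‖ ≤ (‖a 0‖ + ‖a 1‖ + 1) * (|x| + |s|) := by
  refine (norm_add_le _ _).trans ?_
  rw [norm_smul, norm_smul, Real.norm_eq_abs, Real.norm_eq_abs]
  have h1 := norm_nonneg (a 0)
  have h2 := norm_nonneg (a 1)
  have h3 := abs_nonneg x
  have h4 := abs_nonneg s
  nlinarith [mul_nonneg h1 h4, mul_nonneg h2 h3]

theorem summable_exp_neg_mul_abs_int {η : ℝ} (hη : 0 < η) :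
    Summable fun m : ℤ => Real.exp (-η * |(m : ℝ)|) := by
  have h : Summable fun m : ℕ => Real.exp (-η * |((m : ℤ) : ℝ)|) := by
    have h1 : ∀ m : ℕ, Real.exp (-η * |((m : ℤ) : ℝ)|) = Real.exp (-η) ^ m := by
      intro m
      rw [← Real.exp_nat_mul]
      congr 1
      simp [mul_comm]
    simp only [h1]
    exact summable_geometric_of_lt_one (Real.exp_pos _).le (Real.exp_lt_one_iff.2 (by linarith))
  refine Summable.of_nat_of_neg h ?_
  simpa using h

theorem summable_exp_neg_mul_norm_lattice {a : Fin 2 → Plane} (ha : LinearIndependent ℝ a) {η : ℝ}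
    (hη : 0 < η) : Summable fun R : lattice a => Real.exp (-η * ‖(R : Plane)‖) := by
  obtain ⟨K, hK, h⟩ := exists_abs_add_abs_le_norm_point ha
  have hs := summable_exp_neg_mul_abs_int (div_pos hη hK)
  have hs2 : Summable fun m : ℤ × ℤ =>
      Real.exp (-(η / K) * |(m.1 : ℝ)|) * Real.exp (-(η / K) * |(m.2 : ℝ)|) :=
    hs.mul_of_nonneg hs (fun _ => (Real.exp_pos _).le) (fun _ => (Real.exp_pos _).le)
  have hpt : Summable fun m : ℤ × ℤ => Real.exp (-η * ‖point a m.1 m.2‖) := by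
    refine Summable.of_nonneg_of_le (fun _ => (Real.exp_pos _).le) (fun m => ?_) hs2
    rw [← Real.exp_add, Real.exp_le_exp]
    have h1 := mul_le_mul_of_nonneg_left (h m.1 m.2) (div_pos hη hK).le
    rw [← mul_assoc, div_mul_cancel₀ _ hK.ne'] at h1
    linarith
  choose m₁ m₂ hm using fun R : lattice a => R.2
  have hinj : Function.Injective fun R : lattice a => (m₁ R, m₂ R) := by
    intro R R' h
    simp only [Prod.mk.injEq] at h
    apply Subtype.ext
    rw [hm R, hm R', h.1, h.2]
  refine (hpt.comp_injective hinj).congr fun R => ?_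
  simp only [Function.comp_apply]
  rw [← hm R]

theorem countable_lattice (a : Fin 2 → Plane) : (lattice a).Countable := by
  refine (countable_range fun m : ℤ × ℤ => point a m.1 m.2).mono ?_
  rintro _ ⟨m₁, m₂, rfl⟩
  exact ⟨(m₁, m₂), rfl⟩

/-- Both `‖r‖` and `‖R‖` are at most `‖r + R‖ + ‖R‖`; half of the smaller rate is spent on each. The
factor in `R` is then summable over the lattice. -/
theorem exp_mul_exp_le {η δ : ℝ} (r R : Plane) (hη : 0 < η) (hδ : 0 < δ) :
    Real.exp (-η * ‖r + R‖) * Real.exp (-δ * ‖R‖) ≤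
      Real.exp (-(min η δ / 2) * ‖r‖) * Real.exp (-(min η δ / 2) * ‖R‖) := by
  rw [← Real.exp_add, ← Real.exp_add, Real.exp_le_exp]
  have h1 : ‖r‖ ≤ ‖r + R‖ + ‖R‖ := by
    have := norm_sub_le (r + R) R
    rwa [add_sub_cancel_right] at this
  have h2 : min η δ * ‖r + R‖ ≤ η * ‖r + R‖ :=
    mul_le_mul_of_nonneg_right (min_le_left _ _) (norm_nonneg _)
  have h3 : min η δ * ‖R‖ ≤ δ * ‖R‖ :=
    mul_le_mul_of_nonneg_right (min_le_right _ _) (norm_nonneg _)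
  have h4 : 0 < min η δ := lt_min hη hδ
  have h5 := mul_le_mul_of_nonneg_left h1 h4.le
  have h6 := mul_nonneg h4.le (norm_nonneg (r + R))
  nlinarith

end Decay

section Wannier

variable {a b : Fin 2 → Plane} {U : Plane → State n}

theorem isCompact_cell (b : Fin 2 → Plane) : IsCompact (cell b) := by
  have h : cell b = (fun p : ℝ × ℝ => point b p.1 p.2) '' (paramInterval ×ˢ paramInterval) := by
    ext r
    constructor
    · rintro ⟨s, hs, t, ht, rfl⟩
      exact ⟨(s, t), ⟨hs, ht⟩, rfl⟩
    · rintro ⟨⟨s, t⟩, ⟨hs, ht⟩, rfl⟩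
      exact ⟨s, hs, t, ht, rfl⟩
  rw [h]
  refine (isCompact_Icc.prod isCompact_Icc).image ?_
  simp only [point]
  fun_prop

theorem continuous_apply_state (hU : Continuous U) (i : Fin n) : Continuous fun k => U k i := by
  fun_prop

/-- The Fourier coefficients of a periodic analytic assignment decay exponentially. -/
theorem decaysExponentially_fourierCoefficient (hab : IsReciprocal a b)
    (hU : AnalyticOnNhd ℝ U univ) (hper : IsLatticePeriodic b U) (i : Fin n) :
    DecaysExponentially (lattice a) (fourierCoefficient a b U i) := by
  obtain ⟨L, hL⟩ := exists_pointEquiv_of_linearIndependent (linearIndependent_of_isReciprocal hab)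
  obtain ⟨c, hc, hint⟩ := exists_pos_mul_setIntegral_cell L hL
  have hUc : Continuous U := continuousOn_univ.mp hU.continuousOn
  have hUi : AnalyticOnNhd ℝ (fun k => U k i) univ := fun k _ =>
    ((contDiffAt_piLp 2).1 (hU k trivial).contDiffAt i).analyticAt
  have hperi : IsLatticePeriodic b (fun k => U k i) := fun k G hG =>
    congrArg (fun v => v i) (hper k G hG)
  obtain ⟨C, δ, hC, hδ, h⟩ := (analyticOnNhd_comp_point hUi b).exists_norm_fourier_integral_le
    hperi.add_one_fst hperi.add_one_snd
  set V : ℝ := volume.real (cell a) / (2 * Real.pi) ^ 2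
  have hV : 0 ≤ V := by positivity
  set K : ℝ := ‖a 0‖ + ‖a 1‖ + 1
  have hK : 0 < K := by positivity
  refine ⟨V * c * C + 1, δ / K, by positivity, by positivity, ?_⟩
  rintro R ⟨m₁, m₂, rfl⟩
  have hcont : Continuous fun k => Complex.exp (-Complex.I *
      (inner ℝ (point a (m₁ : ℝ) (m₂ : ℝ)) k : ℝ)) * U k i := by
    have := continuous_apply_state hUc i
    fun_prop
  have h1 : fourierCoefficient a b U i (point a m₁ m₂) = V * (c *
      ∫ x in (-(1 / 2) : ℝ)..(1 / 2), ∫ y in (-(1 / 2) : ℝ)..(1 / 2),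
        Complex.exp (-(2 * Real.pi * (m₁ * x + m₂ * y)) * Complex.I) * U (point b x y) i) := by
    rw [fourierCoefficient, hint _ hcont]
    simp only [inner_point_point hab]
    congr 6
    ext x
    congr 1
    ext y
    congr 2
    push_cast
    ring
  rw [h1, norm_mul, norm_mul, Complex.norm_real, Complex.norm_real, Real.norm_of_nonneg hV,
    Real.norm_of_nonneg hc.le]
  have h2 := h m₁ m₂
  have h3 : Real.exp (-δ * (|(m₁ : ℝ)| + |(m₂ : ℝ)|)) ≤
      Real.exp (-(δ / K) * ‖point a (m₁ : ℝ) (m₂ : ℝ)‖) := by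
    rw [Real.exp_le_exp]
    have h4 := mul_le_mul_of_nonneg_left (norm_point_le a m₁ m₂) (div_pos hδ hK).le
    rw [← mul_assoc, div_mul_cancel₀ _ hK.ne'] at h4
    linarith
  calc V * (c * _) ≤ V * (c * (C * Real.exp (-δ * (|(m₁ : ℝ)| + |(m₂ : ℝ)|)))) := by gcongr
    _ ≤ V * (c * (C * Real.exp (-(δ / K) * ‖point a (m₁ : ℝ) (m₂ : ℝ)‖))) := by gcongr
    _ = V * c * C * Real.exp (-(δ / K) * ‖point a (m₁ : ℝ) (m₂ : ℝ)‖) := by ring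
    _ ≤ (V * c * C + 1) * Real.exp (-(δ / K) * ‖point a (m₁ : ℝ) (m₂ : ℝ)‖) := by
        gcongr
        linarith

theorem summable_orbital {orb : Plane → ℝ} (ha : LinearIndependent ℝ a)
    (horb : DecaysExponentially univ orb) (r : Plane) :
    Summable fun R : lattice a => ‖(orb (r + R) : ℂ)‖ := by
  obtain ⟨C, η, hC, hη, h⟩ := horb
  refine Summable.of_nonneg_of_le (fun _ => norm_nonneg _) (fun R => ?_)
    ((summable_exp_neg_mul_norm_lattice ha hη).mul_left (C * Real.exp (η * ‖r‖)))
  rw [Complex.norm_real]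
  refine (h (r + R) trivial).trans ?_
  rw [mul_assoc, ← Real.exp_add]
  gcongr
  have h1 : ‖(R : Plane)‖ ≤ ‖r + R‖ + ‖r‖ := by
    have := norm_sub_le (r + (R : Plane)) r
    rwa [add_sub_cancel_left] at this
  nlinarith

/-- The lattice sum and the integral over the cell may be exchanged, since the terms are dominated
by `|orb i (r + R)|`. The result is a convolution, for which decay of both factors suffices. -/
theorem wannierFunction_eq (ha : LinearIndependent ℝ a) (hU : Continuous U)
    (hU1 : ∀ k, ‖U k‖ = 1) {orb : Fin n → Plane → ℝ}
    (horb : ∀ i, DecaysExponentially univ (orb i)) (r : Plane) :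
    wannierFunction a b orb U r =
      ∑ i, ∑' R : lattice a, (orb i (r + R) : ℂ) * fourierCoefficient a b U i R := by
  have hUi := continuous_apply_state hU
  have hUn : ∀ i k, ‖U k i‖ ≤ 1 := fun i k => (hU1 k) ▸ PiLp.norm_apply_le (U k) i
  have hen : ∀ k R : Plane, ‖Complex.exp (-Complex.I * (inner ℝ k R : ℝ))‖ = 1 := by
    intro k R
    rw [← Complex.norm_exp_ofReal_mul_I (-(inner ℝ k R : ℝ))]
    congr 2
    push_cast
    ring
  let F : Fin n → lattice a → Plane → ℂ := fun i R k =>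
    U k i * (Complex.exp (-Complex.I * (inner ℝ k (R : Plane) : ℝ)) * (orb i (r + R) : ℂ))
  have hFc : ∀ i R, Continuous (F i R) := by
    intro i R
    have := hUi i
    simp only [F]
    fun_prop
  have hFn : ∀ i R k, ‖F i R k‖ ≤ ‖(orb i (r + R) : ℂ)‖ := by
    intro i R k
    simp only [F, norm_mul, hen, one_mul]
    exact mul_le_of_le_one_left (norm_nonneg _) (hUn i k)
  have hFi : ∀ i R, IntegrableOn (F i R) (cell b) := fun i R =>
    (hFc i R).continuousOn.integrableOn_compact (isCompact_cell b)
  have hbloch : ∀ i k, U k i * blochLike a (orb i) k r = ∑' R, F i R k := fun i k => by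
    rw [blochLike, ← tsum_mul_left]
  have hsumc : ∀ i, Continuous fun k => ∑' R, F i R k := fun i =>
    continuous_tsum (hFc i) (summable_orbital ha (horb i) r) (hFn i)
  have hfin : volume (cell b) < ⊤ := (isCompact_cell b).measure_lt_top
  have hsumm : ∀ i, Summable fun R : lattice a => ∫ k in cell b, ‖F i R k‖ := by
    intro i
    refine Summable.of_nonneg_of_le (fun R => integral_nonneg fun _ => norm_nonneg _)
      (fun R => ?_) ((summable_orbital ha (horb i) r).mul_right (volume.real (cell b)))
    have := norm_setIntegral_le_of_norm_le_const (f := fun k => ‖F i R k‖) hfin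
      (fun k _ => by rw [norm_norm]; exact hFn i R k)
    exact (le_abs_self _).trans this
  rw [wannierFunction]
  simp only [hbloch]
  rw [integral_finsetSum _ fun i _ =>
    (hsumc i).continuousOn.integrableOn_compact (isCompact_cell b), Finset.mul_sum]
  refine Finset.sum_congr rfl fun i _ => ?_
  have := (countable_lattice a).to_subtype
  rw [← integral_tsum_of_summable_integral_norm (hFi i) (hsumm i), ← tsum_mul_left]
  refine tsum_congr fun R => ?_
  have h1 : ∀ k, F i R k = (orb i (r + R) : ℂ) *
      (Complex.exp (-Complex.I * (inner ℝ (R : Plane) k : ℝ)) * U k i) := by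
    intro k
    simp only [F, real_inner_comm k]
    ring
  simp only [h1]
  rw [integral_const_mul, fourierCoefficient]
  ring

/-- Exponential decay of the Wannier function of an assignment with exponentially decaying
Fourier coefficients, for exponentially decaying orbitals. -/
theorem decaysExponentially_wannierFunction (ha : LinearIndependent ℝ a) (hU : Continuous U)
    (hU1 : ∀ k, ‖U k‖ = 1)
    (hF : ∀ i, DecaysExponentially (lattice a) (fourierCoefficient a b U i))
    {orb : Fin n → Plane → ℝ} (horb : ∀ i, DecaysExponentially univ (orb i)) :
    DecaysExponentially univ (wannierFunction a b orb U) := by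
  have h : wannierFunction a b orb U = fun r => ∑ i, ∑' R : lattice a,
      (orb i (r + R) : ℂ) * fourierCoefficient a b U i R :=
    funext fun r => wannierFunction_eq ha hU hU1 horb r
  rw [h]
  refine decaysExponentially_sum _ fun i => ?_
  obtain ⟨C, η, hC, hη, h₁⟩ := horb i
  obtain ⟨C', δ, hC', hδ, h₂⟩ := hF i
  have hd : 0 < min η δ / 2 := half_pos (lt_min hη hδ)
  have hs := summable_exp_neg_mul_norm_lattice ha hd
  set S : ℝ := ∑' R : lattice a, Real.exp (-(min η δ / 2) * ‖(R : Plane)‖)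
  have hS : 0 ≤ S := tsum_nonneg fun _ => (Real.exp_pos _).le
  refine ⟨C * C' * S + 1, min η δ / 2, by positivity, hd, fun r _ => ?_⟩
  have hle : ∀ R : lattice a, ‖(orb i (r + R) : ℂ) * fourierCoefficient a b U i R‖ ≤
      C * C' * Real.exp (-(min η δ / 2) * ‖r‖) * Real.exp (-(min η δ / 2) * ‖(R : Plane)‖) := by
    intro R
    rw [norm_mul, Complex.norm_real]
    calc _ ≤ (C * Real.exp (-η * ‖r + R‖)) * (C' * Real.exp (-δ * ‖(R : Plane)‖)) := by
          gcongr
          · exact h₁ _ trivial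
          · exact h₂ _ R.2
      _ = C * C' * (Real.exp (-η * ‖r + R‖) * Real.exp (-δ * ‖(R : Plane)‖)) := by ring
      _ ≤ C * C' * (Real.exp (-(min η δ / 2) * ‖r‖) *
            Real.exp (-(min η δ / 2) * ‖(R : Plane)‖)) := by
          exact mul_le_mul_of_nonneg_left (exp_mul_exp_le r R hη hδ) (by positivity)
      _ = _ := by ring
  have h3 := tsum_of_norm_bounded
    (hs.hasSum.mul_left (C * C' * Real.exp (-(min η δ / 2) * ‖r‖))) hle
  refine h3.trans ?_
  have h4 := Real.exp_pos (-(min η δ / 2) * ‖r‖)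
  nlinarith

end Wannier

end MatrixModel

end

/-! ### Unwinding the phase and comparison with arbitrary data -/

section

open MeasureTheory Filter Topology Set
open scoped ENNReal NNReal ContDiff

namespace MatrixModel
variable {n : ℕ}

section CorrectedSection

variable {P : Plane → State n →L[ℂ] State n} {a b : Fin 2 → Plane}

theorem norm_cexp_neg_I_mul (x y : ℝ) : ‖Complex.exp (-Complex.I * x * (y + 1 / 2))‖ = 1 := by
  rw [← Complex.norm_exp_ofReal_mul_I (-(x * (y + 1 / 2)))]
  congr 2
  push_cast
  ring

theorem IsLatticePeriodic.comp_point_half_eq {X : Type*} {f : Plane → X}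
    (hf : IsLatticePeriodic b f) (x : ℝ) :
    f (point b x (1 / 2)) = f (point b x (-(1 / 2))) := by
  have := hf.add_one_snd (x, -(1 / 2))
  norm_num at this
  exact this

theorem isLatticePeriodic_of_comp_point (hb : LinearIndependent ℝ b) {X : Type*} {U : Plane → X}
    (h₁ : ∀ x s, U (point b (x + 1) s) = U (point b x s))
    (h₂ : ∀ x s, U (point b x (s + 1)) = U (point b x s)) : IsLatticePeriodic b U := by
  obtain ⟨L, hL⟩ := exists_pointEquiv_of_linearIndependent hb
  rintro k _ ⟨m₁, m₂, rfl⟩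
  obtain ⟨⟨x, s⟩, rfl⟩ := L.surjective k
  rw [hL, ← point_add]
  have h3 : Function.Periodic (fun x => U (point b x (s + m₂))) 1 := fun x => h₁ x _
  have h4 : Function.Periodic (fun s => U (point b x s)) 1 := fun s => h₂ x s
  have h5 := h3.int_mul m₁ x
  have h6 := h4.int_mul m₂ s
  simp only [mul_one] at h5 h6
  rw [h5, h6]

theorem deriv_comp_point_snd (hPa : AnalyticOnNhd ℝ P univ) (b : Fin 2 → Plane) (x s : ℝ) :
    deriv (fun t => P (point b x t)) s =
      fderiv ℝ (fun p : ℝ × ℝ => P (point b p.1 p.2)) (x, s) (0, 1) :=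
  (hasDerivAt_snd_slice (f := fun p : ℝ × ℝ => P (point b p.1 p.2))
    (analyticOnNhd_comp_point hPa b (x, s) trivial).differentiableAt).deriv

theorem deriv_comp_point_fst (hPa : AnalyticOnNhd ℝ P univ) (b : Fin 2 → Plane) (x s : ℝ) :
    deriv (fun t => P (point b t s)) x =
      fderiv ℝ (fun p : ℝ × ℝ => P (point b p.1 p.2)) (x, s) (1, 0) :=
  (hasDerivAt_fst_slice (f := fun p : ℝ × ℝ => P (point b p.1 p.2))
    (analyticOnNhd_comp_point hPa b (x, s) trivial).differentiableAt).deriv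

theorem continuous_deriv_comp_point_snd (hPa : AnalyticOnNhd ℝ P univ) (b : Fin 2 → Plane)
    (x : ℝ) : Continuous (deriv fun t => P (point b x t)) := by
  rw [funext (deriv_comp_point_snd hPa b x)]
  exact (continuous_fderiv_slice (analyticOnNhd_comp_point hPa b) (0, 1)).comp
    (f := fun s : ℝ => (x, s)) (by fun_prop)

theorem continuous_deriv_comp_point_fst (hPa : AnalyticOnNhd ℝ P univ) (b : Fin 2 → Plane)
    (s : ℝ) : Continuous (deriv fun t => P (point b t s)) := by
  rw [funext fun x => deriv_comp_point_fst hPa b x s]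
  exact (continuous_fderiv_slice (analyticOnNhd_comp_point hPa b) (1, 0)).comp
    (f := fun x : ℝ => (x, s)) (by fun_prop)

theorem IsParallelTransport.eqOn {γ : ℝ → Plane} (hγ : Continuous (deriv fun t => P (γ t)))
    {v w : ℝ → State n} (hv : IsParallelTransport P γ v) (hw : IsParallelTransport P γ w)
    (h : v (-(1 / 2)) = w (-(1 / 2))) : EqOn v w paramInterval :=
  eqOn_Icc_of_hasDerivWithinAt_clm hγ hv hw h

theorem isParallelTransport_slice (hPa : AnalyticOnNhd ℝ P univ) {u : ℝ × ℝ → State n}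
    (hu : IsTransportedSection (fun p => P (point b p.1 p.2)) u) (x : ℝ) :
    IsParallelTransport P (fun s => point b x s) (fun s => u (x, s)) := by
  intro s _
  rw [deriv_comp_point_snd hPa]
  exact (hu.hasDerivAt x s).hasDerivWithinAt

/-- Unwinding the phase of a transported section turns it into a periodic analytic assignment. -/
theorem exists_periodic_assignment (hb : LinearIndependent ℝ b) (hPa : AnalyticOnNhd ℝ P univ)
    (hper : IsLatticePeriodic b P) {u : ℝ × ℝ → State n}
    (hu : IsTransportedSection (fun p => P (point b p.1 p.2)) u) (hu₁ : ∀ p, u (p + (1, 0)) = u p)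
    {ψ : ℝ → ℝ} (hψ : AnalyticOnNhd ℝ ψ univ) (hψ₁ : ∀ x, ψ (x + 1) = ψ x)
    (hψu : ∀ x, u (x, 1 / 2) = Complex.exp (Complex.I * ψ x) • u (x, -(1 / 2))) :
    ∃ U : Plane → State n,
      (∀ x s : ℝ, U (point b x s) = Complex.exp (-Complex.I * ψ x * (s + 1 / 2)) • u (x, s)) ∧
      AnalyticOnNhd ℝ U univ ∧ IsLatticePeriodic b U ∧ (∀ k, P k (U k) = U k) ∧
      ∀ k, ‖U k‖ = 1 := by
  obtain ⟨L, hL⟩ := exists_pointEquiv_of_linearIndependent hb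
  let V : ℝ × ℝ → State n := fun p => Complex.exp (-Complex.I * ψ p.1 * (p.2 + 1 / 2)) • u p
  have hVU : ∀ x s : ℝ, V (L.symm (point b x s)) = V (x, s) := fun x s => by
    rw [← hL (x, s), L.symm_apply_apply]
  have hVa : AnalyticOnNhd ℝ V univ := by
    intro p _
    have h1 : AnalyticAt ℝ (fun p : ℝ × ℝ => (ψ p.1 : ℂ)) p :=
      (Complex.ofRealCLM.analyticAt _).comp
        (AnalyticAt.comp (g := ψ) (hψ p.1 trivial) analyticAt_fst)
    have h2 : AnalyticAt ℝ (fun p : ℝ × ℝ => (p.2 : ℂ)) p :=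
      (Complex.ofRealCLM.analyticAt _).comp analyticAt_snd
    exact (analyticAt_cexp_real ((analyticAt_const.mul h1).mul (h2.add analyticAt_const))).smul
      (hu.analytic p trivial)
  -- The factor `exp (i ψ x)` gained by `u` over a period in `s` is cancelled exactly by the
  -- increment of `exp (-i ψ x (s + 1/2))`.
  have hu₂ := hu.add_one_snd (analyticOnNhd_comp_point hPa b) hper.add_one_snd
    (s₀ := -(1 / 2)) (c := fun x => Complex.exp (Complex.I * ψ x)) (fun x => by
      rw [← hψu x]
      norm_num)
  refine ⟨fun k => V (L.symm k), fun x s => hVU x s, fun k _ => ?_, ?_, fun k => ?_, fun k => ?_⟩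
  · exact AnalyticAt.comp (g := V) (hVa _ trivial)
      ((L.symm : Plane →L[ℝ] ℝ × ℝ).analyticAt k)
  · refine isLatticePeriodic_of_comp_point hb (fun x s => ?_) (fun x s => ?_)
    · rw [hVU, hVU]
      have := hu₁ (x, s)
      simp only [Prod.mk_add_mk, add_zero] at this
      simp only [V, hψ₁, this]
    · rw [hVU, hVU]
      simp only [V, hu₂, smul_smul, ← Complex.exp_add]
      congr 2
      push_cast
      ring
  · have h1 := hu.apply_eq (L.symm k)
    rw [← hL, L.apply_symm_apply] at h1
    simp only [V, map_smul, h1]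
  · simp only [V, norm_smul, norm_cexp_neg_I_mul, hu.norm_eq, mul_one]

theorem exists_isTwoStageConstruction (hab : IsReciprocal a b)
    (hP : ∀ k, IsRankOneProjection (P k))
    (hPa : AnalyticOnNhd ℝ P univ) (hper : IsLatticePeriodic b P) (hC : chernNumber b P = 0)
    {v₀ : State n} (hv₀ : ‖v₀‖ = 1) (hPv₀ : P (point b (-(1 / 2)) (-(1 / 2))) v₀ = v₀) :
    ∃ u₀ φ₁ u φ₂, IsTwoStageConstruction b P v₀ u₀ φ₁ u φ₂ := by
  obtain ⟨w, hw0, hw, ⟨θ, hθ⟩, hg⟩ := exists_global_transport hP hPa hper hv₀ hPv₀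
  obtain ⟨u, hu, hu0, hu₁⟩ := hg θ hθ
  have hQ₂ := hper.comp_point_half_eq
  obtain ⟨c, hc⟩ := (hP (point b (-(1 / 2)) (-(1 / 2)))).exists_phase
    (hu.norm_eq (-(1 / 2), -(1 / 2))) (hu.apply_eq (-(1 / 2), -(1 / 2)))
    (hu.norm_eq (-(1 / 2), 1 / 2))
    (by rw [← hQ₂]; exact hu.apply_eq (-(1 / 2), 1 / 2))
  obtain ⟨ψ, hψ, -, -, hψu⟩ := hu.exists_periodic_phase (fun p => hP _)
    (analyticOnNhd_comp_point hPa b) hQ₂ hu₁ (integral_curvatureTrace_eq_zero hab hPa hC) hc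
  exact ⟨w, θ, fun x s => u (x, s), ψ, hw0, fun x _ => (hw x).hasDerivWithinAt, hθ,
    fun x _ => hu0 x, fun x _ => isParallelTransport_slice hPa hu x,
    (continuousOn_univ.1 hψ.continuousOn).continuousOn, fun x _ => hψu x⟩

/-- The outcome of the two-stage construction is the restriction of a periodic analytic
assignment. -/
theorem IsTwoStageConstruction.exists_extension (hab : IsReciprocal a b)
    (hP : ∀ k, IsRankOneProjection (P k))
    (hPa : AnalyticOnNhd ℝ P univ) (hper : IsLatticePeriodic b P) (hC : chernNumber b P = 0)
    {v₀ : State n} (hv₀ : ‖v₀‖ = 1) (hPv₀ : P (point b (-(1 / 2)) (-(1 / 2))) v₀ = v₀)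
    {u₀ : ℝ → State n} {φ₁ : ℝ} {u : ℝ → ℝ → State n} {φ₂ : ℝ → ℝ}
    (h : IsTwoStageConstruction b P v₀ u₀ φ₁ u φ₂) :
    ∃ U : Plane → State n,
      (∀ κ₁ ∈ paramInterval, ∀ κ₂ ∈ paramInterval,
        U (point b κ₁ κ₂) = correctedAssignment u φ₂ κ₁ κ₂) ∧
      AnalyticOnNhd ℝ U univ ∧ IsLatticePeriodic b U ∧ (∀ k, P k (U k) = U k) ∧
      ∀ k, ‖U k‖ = 1 := by
  obtain ⟨w, hw0, hw, -, hg⟩ := exists_global_transport hP hPa hper hv₀ hPv₀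
  have hl : (-(1 / 2) : ℝ) ∈ paramInterval := ⟨le_rfl, by norm_num⟩
  have hr : (1 / 2 : ℝ) ∈ paramInterval := ⟨by norm_num, le_rfl⟩
  have hu₀ : EqOn u₀ w paramInterval := h.transport₁.eqOn
    (continuous_deriv_comp_point_fst hPa b _) (fun x _ => (hw x).hasDerivWithinAt)
    (h.initial.trans hw0.symm)
  -- The global section is built with the given `φ₁`, so that its initial values coincide with those
  -- of the given `u`.
  obtain ⟨ug, hug, hug0, hug₁⟩ := hg φ₁ (by rw [← hu₀ hl, ← hu₀ hr, h.phase₁])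
  have hu : ∀ x ∈ paramInterval, EqOn (u x) (fun s => ug (x, s)) paramInterval := fun x hx =>
    (h.transport₂ x hx).eqOn (continuous_deriv_comp_point_snd hPa b x)
      (isParallelTransport_slice hPa hug x) (by rw [h.initial₂ x hx, hug0, hu₀ hx])
  have hphase : ∀ x ∈ paramInterval,
      ug (x, 1 / 2) = Complex.exp (Complex.I * φ₂ x) • ug (x, -(1 / 2)) := fun x hx => by
    have := h.phase₂ x hx
    rwa [hu x hx hl, hu x hx hr] at this
  have hQ₂ := hper.comp_point_half_eq
  -- The free initial value is taken to be `φ₂ (-1/2)`; two continuous branches that agree there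
  -- coincide, so the given `φ₂` is the restriction of the analytic periodic `ψ`.
  obtain ⟨ψ, hψ, hψ0, hψ₁, hψu⟩ := hug.exists_periodic_phase (fun p => hP _)
    (analyticOnNhd_comp_point hPa b) hQ₂ hug₁ (integral_curvatureTrace_eq_zero hab hPa hC)
    (hphase _ hl)
  have hφψ : EqOn φ₂ ψ paramInterval := by
    refine eqOn_of_cexp_eq (by norm_num) h.continuous_phase₂
      (continuousOn_univ.1 hψ.continuousOn).continuousOn hψ0.symm fun x hx => ?_
    have hne : ug (x, -(1 / 2)) ≠ 0 := norm_ne_zero_iff.1 (by rw [hug.norm_eq]; exact one_ne_zero)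
    exact smul_left_injective ℂ hne ((hphase x hx).symm.trans (hψu x))
  obtain ⟨U, hU, hrest⟩ := exists_periodic_assignment (linearIndependent_of_isReciprocal hab)
    hPa hper hug hug₁ hψ hψ₁ hψu
  refine ⟨U, fun x hx s hs => ?_, hrest⟩
  rw [hU, correctedAssignment, hφψ hx, hu x hx hs]

end CorrectedSection

end MatrixModel

end

theorem mainTheorem1 {n : ℕ}
    (a b : Fin 2 → MatrixModel.Plane)
    (ha : LinearIndependent ℝ a)
    (hab : MatrixModel.IsReciprocal a b)
    (H : MatrixModel.Plane → Matrix (Fin n) (Fin n) ℂ)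
    (hH_herm : ∀ k, (H k).IsHermitian)
    (hH_analytic : ∀ i j, AnalyticOnNhd ℝ (fun k => H k i j) Set.univ)
    (hH_periodic : MatrixModel.IsLatticePeriodic b H)
    (E : MatrixModel.Plane → ℝ)
    (hE_cont : Continuous E)
    (hE_simple : ∀ k, Module.finrank ℂ (MatrixModel.bandSpace H E k) = 1)
    (hC : MatrixModel.chernNumber b (MatrixModel.bandProjector H E) = 0)
    (v₀ : MatrixModel.State n)
    (hv₀ : v₀ ∈ MatrixModel.bandSpace H E (MatrixModel.point b (-(1 / 2)) (-(1 / 2))))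
    (hv₀_norm : ‖v₀‖ = 1) :
    (∃ u₀ φ₁ u φ₂, MatrixModel.IsTwoStageConstruction b (MatrixModel.bandProjector H E)
      v₀ u₀ φ₁ u φ₂) ∧
    ∀ u₀ φ₁ u φ₂, MatrixModel.IsTwoStageConstruction b (MatrixModel.bandProjector H E)
      v₀ u₀ φ₁ u φ₂ →
      ∃ U : MatrixModel.Plane → MatrixModel.State n,
        (∀ κ₁ ∈ MatrixModel.paramInterval, ∀ κ₂ ∈ MatrixModel.paramInterval,
          U (MatrixModel.point b κ₁ κ₂) = MatrixModel.correctedAssignment u φ₂ κ₁ κ₂) ∧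
        AnalyticOnNhd ℝ U Set.univ ∧
        MatrixModel.IsLatticePeriodic b U ∧
        (∀ k, U k ∈ MatrixModel.bandSpace H E k ∧ ‖U k‖ = 1) ∧
        (∀ i, MatrixModel.DecaysExponentially (MatrixModel.lattice a)
          (MatrixModel.fourierCoefficient a b U i)) ∧
        (∀ orb : Fin n → MatrixModel.Plane → ℝ,
          (∀ i, MatrixModel.DecaysExponentially Set.univ (orb i)) →
          MatrixModel.DecaysExponentially Set.univ
            (MatrixModel.wannierFunction a b orb U)) := by
  have hP := MatrixModel.isRankOneProjection_bandProjector hE_simple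
  have hPa := MatrixModel.analyticOnNhd_bandProjector hH_herm hH_analytic hE_cont hE_simple
  have hper := MatrixModel.isLatticePeriodic_bandProjector hH_periodic
    (MatrixModel.isLatticePeriodic_eigenvalue hH_herm hH_analytic hH_periodic hE_cont hE_simple)
  have hPv₀ := MatrixModel.bandProjector_eq_self_iff.2 hv₀
  refine ⟨MatrixModel.exists_isTwoStageConstruction hab hP hPa hper hC hv₀_norm hPv₀,
    fun u₀ φ₁ u φ₂ h => ?_⟩
  obtain ⟨U, hU, hUa, hUper, hPU, hU1⟩ := h.exists_extension hab hP hPa hper hC hv₀_norm hPv₀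
  have hF := MatrixModel.decaysExponentially_fourierCoefficient hab hUa hUper
  exact ⟨U, hU, hUa, hUper, fun k => ⟨MatrixModel.bandProjector_eq_self_iff.1 (hPU k), hU1 k⟩, hF,
    fun orb horb => MatrixModel.decaysExponentially_wannierFunction ha
      (continuousOn_univ.1 hUa.continuousOn) hU1 hF horb⟩
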